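/- Let $d\ge 1$ be odd, $L\ge 1$, and let $\epsilon$ be a real random variable with $\mathbb{E}[\epsilon]=\mathbb{E}[\epsilon^3]=0$, $|\epsilon|\le b$ almost surely, $\nu:=\mathbb{E}[\epsilon^2]>0$ and $\mathbb{E}[\epsilon^4]=2\nu^2$. Let $\epsilon_{l,i}$ ($1\le l\le L$, $1\le i\le d$) be independent copies of $\epsilon$, and put $D_l=\operatorname{diag}(\epsilon_{l,1},\dots,\epsilon_{l,d})$, $f_k=\sum_{j=1}^d e^{2\pi i jk/d}e_j\in\mathbb{C}^d$, $F_{k,l}=D_lf_kf_k^*D_l$ and $\mathcal{A}(Z)=(\operatorname{tr}(F_{k,l}Z))_{1\le k\le d,\,1\le l\le L}$. Let $x\in\mathbb{C}^d$ with $\|x\|_{\ell_2}=1$ and let $T=\{xz^*+zx^*: z\in\mathbb{C}^d\}$ be the tangent space at $xx^*$. Write $\|\cdot\|_2$ for the Frobenius norm. There are absolute constants $C_1,\tilde C_1>0$ (independent of $d$, $L$, $x$, $\epsilon$, $b$, $\nu$, $\delta$) such that the following holds. With probability of failure smaller than $d^2\exp\left(-\frac{\nu^4L}{C_1b^8}\right)$,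 one has $$\frac{1}{\nu^2dL}\,\|\mathcal{A}(Z)\|_{\ell_2}^2>\frac14\|Z\|_2^2\qquad\text{for all } Z\in T\setminus\{0\}\text{ simultaneously}.$$ More generally, for every $\delta\in(0,1)$, with probability of failure at most $d^2\exp\left(-\frac{\nu^4\delta^2L}{\tilde C_1b^8}\right)$, one has $$\frac{1}{\nu^2dL}\,\|\mathcal{A}(Z)\|_{\ell_2}^2>(1-\delta)\|Z\|_2^2\qquad\text{for all } Z\in T\setminus\{0\}\text{ simultaneously}.$$ -/

import Mathlib

open MeasureTheory ProbabilityTheory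

/-! `d × d` complex matrices carry the Frobenius norm throughout, so for hermitian `Z` one has
`‖Z‖ ^ 2 = tr (Z ^ 2)`. -/
attribute [local instance] Matrix.frobeniusNormedAddCommGroup

namespace CodedDiffraction

noncomputable section

/-- The Fourier vector `f_k`, with entries `exp (2πi / d) ^ (j k)`. The indices `j, k` run over
`1, …, d`, so the elements `0, …, d - 1` of `Fin d` are shifted by one. -/
def fourierVec {d : ℕ} (k : Fin d) : Fin d → ℂ :=
  fun j => Complex.exp (2 * Real.pi * Complex.I / d) ^ (((j : ℕ) + 1) * ((k : ℕ) + 1))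

/-- The diagonal modulation matrix `D` with real diagonal entries `a_1, …, a_d`. -/
def maskMatrix {d : ℕ} (a : Fin d → ℝ) : Matrix (Fin d) (Fin d) ℂ :=
  Matrix.diagonal fun i => (a i : ℂ)

/-- The lifted measurement matrix `F_k = D f_k f_k^* D` for the modulation pattern `a`. -/
def measurementMatrix {d : ℕ} (a : Fin d → ℝ) (k : Fin d) : Matrix (Fin d) (Fin d) ℂ :=
  maskMatrix a * Matrix.vecMulVec (fourierVec k) (star (fourierVec k)) * maskMatrix a

/-- The measurement operator `𝒜`, which maps `Z` to the family of all `tr (F_{k,l} Z)`, where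
`a l` is the `l`-th modulation pattern. For hermitian `Z` every entry is real; the norm on the
target is the `ℓ₂`-norm. -/
def measurementOp {d L : ℕ} (a : Fin L → Fin d → ℝ) (Z : Matrix (Fin d) (Fin d) ℂ) :
    EuclideanSpace ℂ (Fin d × Fin L) :=
  WithLp.toLp 2 fun p => (measurementMatrix (a p.2) p.1 * Z).trace

/-- The tangent space `T = {x z^* + z x^* : z ∈ ℂ^d}` at `x x^*`. -/
def tangentSpace {d : ℕ} (x : EuclideanSpace ℂ (Fin d)) : Set (Matrix (Fin d) (Fin d) ℂ) :=
  {Z | ∃ z : Fin d → ℂ,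
    Z = Matrix.vecMulVec x.ofLp (star z) + Matrix.vecMulVec z (star x.ofLp)}

/-- The inequality `(ν² d L)⁻¹ ‖𝒜(Z)‖² > c ‖Z‖²`, for all nonzero `Z` in the tangent space at
`x x^*` simultaneously. -/
def RobustlyInjective {d L : ℕ} (ν c : ℝ) (x : EuclideanSpace ℂ (Fin d))
    (a : Fin L → Fin d → ℝ) : Prop :=
  ∀ Z ∈ tangentSpace x, Z ≠ 0 →
    (ν ^ 2 * d * L)⁻¹ * ‖measurementOp a Z‖ ^ 2 > c * ‖Z‖ ^ 2

end

end CodedDiffraction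

namespace CodedDiffraction

open Filter Topology Matrix

/-! ### The Lie product formula in a Banach algebra. -/

section LieProduct

variable {A : Type*} [NormedRing A]

/-! The claim is a lower tail bound for the least eigenvalue of a sum of `L` independent positive
semidefinite matrices. On the tangent space all measurements are real, so in a real orthonormal
basis of `T` (of dimension at most `2d - 1 ≤ d²`) the quantity `(ν² d)⁻¹ ∑ₖ tr(Fₖ Z)²` for one mask
is a quadratic form with matrix `M = formMatrix`, and the assertion says that `∑ₗ Mₗ` exceeds `(1 -
δ) L` times the identity.

Mean. The condition `E ε⁴ = 2ν²` makes the mixed fourth moments a sum over the three pairings minus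
the all-equal term. Summing over the Fourier index, the third pairing collapses to the diagonal
because `2` is invertible modulo the odd number `d`, and it cancels the correction. Hence the
expected energy is exactly `ν² d (|tr Z|² + ‖Z‖²)`, so `E M` dominates the identity
(`sum_integral_norm_trace_sq`).

Second moment. Cauchy–Schwarz and Parseval bound `|M c|²` by a sum of products of six amplitudes `⟨D
fₖ, ·⟩` (`dotProduct_self_formMatrix_mulVec_le`). These are subgaussian, so `E M²` is at most `s =
O(b⁸/ν⁴)` times the identity, independently of `d`.

Concentration. Since `e⁻ˣ ≤ 1 - x + x²/2` for every `x ≥ 0`, the mean and the second moment alone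
control `E exp(-tM)`; no uniform bound on `M` is needed, and the truncation usual for the upper tail
is absent. Golden–Thompson peels off the independent summands one at a time, and Markov's inequality
with `t = δ/s` yields the tail `dim T · exp(-L δ²/(2s))`
(`measure_exists_dotProduct_sum_mulVec_le`). -/

lemma norm_pow_sub_pow_le_mul [NormOneClass A] {x y : A} {K : ℝ} (hK : 1 ≤ K) (hx : ‖x‖ ≤ K)
    (hy : ‖y‖ ≤ K) (n : ℕ) : ‖x ^ n - y ^ n‖ ≤ n * K ^ n * ‖x - y‖ := by
  have hK0 : 0 ≤ K := zero_le_one.trans hK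
  induction n with
  | zero => simp
  | succ n ih =>
    have h : x ^ (n + 1) - y ^ (n + 1) = x ^ n * (x - y) + (x ^ n - y ^ n) * y := by
      noncomm_ring
    have h1 : ‖x ^ n‖ ≤ K ^ n := (norm_pow_le x n).trans (pow_le_pow_left₀ (norm_nonneg _) hx n)
    calc ‖x ^ (n + 1) - y ^ (n + 1)‖ ≤ ‖x ^ n‖ * ‖x - y‖ + ‖x ^ n - y ^ n‖ * ‖y‖ := by
          rw [h]
          exact (norm_add_le _ _).trans (add_le_add (norm_mul_le _ _) (norm_mul_le _ _))
      _ ≤ K ^ n * ‖x - y‖ + n * K ^ n * ‖x - y‖ * K := by gcongr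
      _ ≤ K ^ n * K * ‖x - y‖ + n * K ^ n * ‖x - y‖ * K := by
          gcongr
          exact le_mul_of_one_le_right (by positivity) hK
      _ = (n + 1 : ℕ) * K ^ (n + 1) * ‖x - y‖ := by push_cast; ring

lemma norm_exp_le [NormOneClass A] [NormedAlgebra ℝ A] [CompleteSpace A] (x : A) :
    ‖NormedSpace.exp x‖ ≤ Real.exp ‖x‖ := by
  have h1 := NormedSpace.exp_series_hasSum_exp' (𝕂 := ℝ) x
  have h2 := NormedSpace.exp_series_hasSum_exp' (𝕂 := ℝ) ‖x‖
  rw [← Real.exp_eq_exp_ℝ] at h2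
  rw [← h1.tsum_eq, ← h2.tsum_eq]
  refine tsum_of_norm_bounded h2.summable.hasSum fun n => ?_
  rw [norm_smul, smul_eq_mul]
  gcongr
  · simp
  · exact norm_pow_le x n

/-- The Lie product formula. -/
theorem tendsto_exp_mul_exp_pow [NormOneClass A] [NormedAlgebra ℝ A] [CompleteSpace A] (a b : A) :
    Tendsto (fun n : ℕ => (NormedSpace.exp ((n : ℝ)⁻¹ • a) * NormedSpace.exp ((n : ℝ)⁻¹ • b)) ^ n)
      atTop (𝓝 (NormedSpace.exp (a + b))) := by
  let g : ℝ → A := fun t => NormedSpace.exp (t • a) * NormedSpace.exp (t • b)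
    - NormedSpace.exp (t • (a + b))
  have hg0 : g 0 = 0 := by simp [g]
  -- Both exponential expressions have derivative `a + b` at `0`, so `g` is `o(t)` and `n ‖g(1/n)‖`
  -- tends to `0`, which absorbs the factor `n` of the telescoping estimate.
  have hd : HasDerivAt g 0 0 := by
    have h1 := hasDerivAt_exp_smul_const (𝕂 := ℝ) a 0
    have h2 := hasDerivAt_exp_smul_const (𝕂 := ℝ) b 0
    have h3 := hasDerivAt_exp_smul_const (𝕂 := ℝ) (a + b) 0
    exact ((h1.mul h2).sub h3).congr_deriv (by simp)
  have hlim : Tendsto (fun n : ℕ => (n : ℝ) * ‖g (n : ℝ)⁻¹‖) atTop (𝓝 0) := by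
    have h1 := hd.isLittleO
    have h2 := h1.comp_tendsto (tendsto_inv_atTop_nhds_zero_nat (𝕜 := ℝ))
    have h3 := (h2.norm_left.norm_right).tendsto_div_nhds_zero
    refine h3.congr fun n => ?_
    simp [hg0, div_eq_mul_inv, mul_comm]
  set c := ‖a‖ + ‖b‖
  have hexp : ∀ x : A, ‖NormedSpace.exp x‖ ≤ Real.exp ‖x‖ := norm_exp_le
  let : NormedAlgebra ℚ A := NormedAlgebra.restrictScalars ℚ ℝ A
  rw [tendsto_iff_norm_sub_tendsto_zero]
  have hup : Tendsto (fun n : ℕ => Real.exp c * ((n : ℝ) * ‖g (n : ℝ)⁻¹‖)) atTop (𝓝 0) := by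
    simpa only [mul_zero] using hlim.const_mul (Real.exp c)
  refine squeeze_zero' (Eventually.of_forall fun _ => norm_nonneg _) ?_ hup
  filter_upwards [eventually_gt_atTop 0] with n hn
  have hn' : (n : ℝ) ≠ 0 := by positivity
  have hY : NormedSpace.exp (a + b) = NormedSpace.exp ((n : ℝ)⁻¹ • (a + b)) ^ n := by
    rw [← NormedSpace.exp_nsmul, ← Nat.cast_smul_eq_nsmul ℝ, smul_smul, mul_inv_cancel₀ hn',
      one_smul]
  -- With `K = exp(c/n)` bounding both bases, the factor `K ^ n` stays equal to `exp c`, uniformly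
  -- in `n`.
  have hKn : Real.exp ((n : ℝ)⁻¹ * c) ^ n = Real.exp c := by
    rw [← Real.exp_nat_mul]; congr 1; field_simp
  rw [hY]
  have hns : ∀ x : A, ‖(n : ℝ)⁻¹ • x‖ = (n : ℝ)⁻¹ * ‖x‖ := fun x => by
    rw [norm_smul, norm_inv, Real.norm_natCast]
  refine (norm_pow_sub_pow_le_mul (K := Real.exp ((n : ℝ)⁻¹ * c)) ?_ ?_ ?_ n).trans (le_of_eq ?_)
  · exact Real.one_le_exp (by positivity)
  · refine (norm_mul_le _ _).trans ((mul_le_mul (hexp _) (hexp _) (norm_nonneg _)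
      (Real.exp_nonneg _)).trans (le_of_eq ?_))
    rw [← Real.exp_add, hns, hns, mul_add]
  · refine (hexp _).trans (Real.exp_le_exp.mpr ?_)
    rw [hns]
    gcongr
    exact norm_add_le _ _
  · rw [hKn]; simp only [g]; ring

end LieProduct

/-! ### Golden–Thompson for real symmetric matrices. -/

section GoldenThompson

variable {n : Type*} [Fintype n] [DecidableEq n]

omit [DecidableEq n] in
lemma abs_trace_mul_le (M N : Matrix n n ℝ) :
    |(M * N).trace| ≤ √(M * Mᵀ).trace * √(N * Nᵀ).trace := by
  have h1 : (M * N).trace = ∑ p : n × n, M p.1 p.2 * N p.2 p.1 := by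
    simp [trace, mul_apply, Fintype.sum_prod_type]
  have h2 : (M * Mᵀ).trace = ∑ p : n × n, M p.1 p.2 ^ 2 := by
    simp [trace, mul_apply, Fintype.sum_prod_type, sq]
  have h3 : (N * Nᵀ).trace = ∑ p : n × n, N p.2 p.1 ^ 2 := by
    rw [Fintype.sum_prod_type_right]
    simp [trace, mul_apply, sq]
  rw [h1, h2, h3]
  rw [← Real.sqrt_mul (Finset.sum_nonneg fun _ _ => sq_nonneg _)]
  exact Real.abs_le_sqrt (Finset.sum_mul_sq_le_sq_mul_sq _ _ _)

lemma trace_mul_pow_comm (M N : Matrix n n ℝ) (k : ℕ) :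
    ((M * N) ^ k).trace = ((N * M) ^ k).trace := by
  cases k with
  | zero => simp
  | succ k =>
    rw [pow_succ, ← mul_assoc, mul_pow_mul, mul_assoc, trace_mul_comm, mul_assoc, ← pow_succ]

/-- The two families are proved together because each feeds the other. The first, applied to `P *
Q`, reduces the second to `P²` and `Q²` at the previous level. The first at the next level comes
from itself applied to `M²`, then the second applied to `Mᵀ * M` and `M * Mᵀ`, and finally
Cauchy–Schwarz for the trace. -/
lemma abs_trace_pow_two_pow_le (k : ℕ) :
    (∀ M : Matrix n n ℝ, |(M ^ 2 ^ (k + 1)).trace| ≤ ((M * Mᵀ) ^ 2 ^ k).trace) ∧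
    ∀ P Q : Matrix n n ℝ, Pᵀ = P → Qᵀ = Q →
      |((P * Q) ^ 2 ^ k).trace| ≤ |(P ^ 2 ^ k * Q ^ 2 ^ k).trace| := by
  induction k with
  | zero =>
    refine ⟨fun M => ?_, fun P Q _ _ => by simp⟩
    have h := abs_trace_mul_le M M
    rw [Real.mul_self_sqrt] at h
    · simpa [sq] using h
    · simp only [trace, mul_apply, diag_apply, transpose_apply]
      exact Finset.sum_nonneg fun _ _ => Finset.sum_nonneg fun _ _ => mul_self_nonneg _
  | succ k ih =>
    obtain ⟨hS, hG⟩ := ih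
    have hGs : ∀ P Q : Matrix n n ℝ, Pᵀ = P → Qᵀ = Q →
        |((P * Q) ^ 2 ^ (k + 1)).trace| ≤ |(P ^ 2 ^ (k + 1) * Q ^ 2 ^ (k + 1)).trace| := by
      intro P Q hP hQ
      refine (hS (P * Q)).trans ?_
      have h1 : ((P * Q * (P * Q)ᵀ) ^ 2 ^ k).trace = ((P ^ 2 * Q ^ 2) ^ 2 ^ k).trace := by
        rw [transpose_mul, hP, hQ, ← mul_assoc, trace_mul_pow_comm]
        simp only [sq, mul_assoc]
      rw [h1]
      refine (le_abs_self _).trans ((hG (P ^ 2) (Q ^ 2) ?_ ?_).trans (le_of_eq ?_))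
      · rw [transpose_pow, hP]
      · rw [transpose_pow, hQ]
      · rw [← pow_mul, ← pow_mul, ← pow_succ']
    refine ⟨fun M => ?_, hGs⟩
    have h1 : M ^ 2 ^ (k + 1 + 1) = (M ^ 2) ^ 2 ^ (k + 1) := by rw [← pow_mul, ← pow_succ']
    rw [h1]
    refine (hS (M ^ 2)).trans ?_
    have h2 : ((M ^ 2 * (M ^ 2)ᵀ) ^ 2 ^ k).trace = (((Mᵀ * M) * (M * Mᵀ)) ^ 2 ^ k).trace := by
      rw [transpose_pow, sq, sq, ← mul_assoc, trace_mul_pow_comm]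
      simp only [mul_assoc]
    have hP : (Mᵀ * M)ᵀ = Mᵀ * M := by simp
    have hQ : (M * Mᵀ)ᵀ = M * Mᵀ := by simp
    rw [h2]
    refine (le_abs_self _).trans ((hG _ _ hP hQ).trans ?_)
    refine (abs_trace_mul_le _ _).trans (le_of_eq ?_)
    rw [transpose_pow, transpose_pow, hP, hQ, ← pow_add, ← pow_add, ← two_mul, ← pow_succ',
      trace_mul_pow_comm Mᵀ M, Real.mul_self_sqrt]
    have h3 : (M * Mᵀ) ^ 2 ^ (k + 1) = (M * Mᵀ) ^ 2 ^ k * ((M * Mᵀ) ^ 2 ^ k)ᵀ := by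
      rw [transpose_pow, hQ, ← pow_add, ← two_mul, ← pow_succ']
    rw [h3]
    simp only [trace, mul_apply, diag_apply, transpose_apply]
    exact Finset.sum_nonneg fun _ _ => Finset.sum_nonneg fun _ _ => mul_self_nonneg _

lemma tendsto_matrix_exp_mul_exp_pow [Nonempty n] (A B : Matrix n n ℝ) :
    Tendsto (fun k : ℕ => (NormedSpace.exp ((k : ℝ)⁻¹ • A) * NormedSpace.exp ((k : ℝ)⁻¹ • B)) ^ k)
      atTop (𝓝 (NormedSpace.exp (A + B))) := by
  -- Any complete submultiplicative norm with `‖1‖ = 1` serves here, since the limit only involves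
  -- the entrywise topology.
  let : NormedRing (Matrix n n ℝ) := Matrix.linftyOpNormedRing
  let : NormedAlgebra ℝ (Matrix n n ℝ) := Matrix.linftyOpNormedAlgebra
  have : NormOneClass (Matrix n n ℝ) := Matrix.linfty_opNormOneClass
  have hc := FiniteDimensional.complete ℝ (n → n → ℝ)
  exact @tendsto_exp_mul_exp_pow (Matrix n n ℝ) _ _ _ hc A B

lemma transpose_exp_eq {A : Matrix n n ℝ} (hA : Aᵀ = A) :
    (NormedSpace.exp A)ᵀ = NormedSpace.exp A := by
  rw [← Matrix.exp_transpose, hA]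

/-- With `X = exp(A/2)` and `Y = exp(B/2)` symmetric, the trace is the squared Frobenius norm of `X
* Y`. This removes the absolute value in the trace inequality. -/
lemma trace_exp_mul_exp_nonneg {A B : Matrix n n ℝ} (hA : Aᵀ = A) (hB : Bᵀ = B) :
    0 ≤ (NormedSpace.exp A * NormedSpace.exp B).trace := by
  have half : ∀ C : Matrix n n ℝ, NormedSpace.exp C =
      NormedSpace.exp ((2 : ℝ)⁻¹ • C) * NormedSpace.exp ((2 : ℝ)⁻¹ • C) := fun C => by
    rw [← Matrix.exp_add_of_commute _ _ (Commute.refl _), ← add_smul]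
    norm_num
  have hA' := transpose_exp_eq (A := (2 : ℝ)⁻¹ • A) (by rw [transpose_smul, hA])
  have hB' := transpose_exp_eq (A := (2 : ℝ)⁻¹ • B) (by rw [transpose_smul, hB])
  set X := NormedSpace.exp ((2 : ℝ)⁻¹ • A)
  set Y := NormedSpace.exp ((2 : ℝ)⁻¹ • B)
  have h : (NormedSpace.exp A * NormedSpace.exp B).trace = ((X * Y) * (X * Y)ᵀ).trace := by
    rw [half A, half B, transpose_mul, hA', hB']
    change (X * X * (Y * Y)).trace = _
    rw [mul_assoc, trace_mul_comm]
    simp only [mul_assoc]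
  rw [h]
  simp only [trace, mul_apply, diag_apply, transpose_apply]
  exact Finset.sum_nonneg fun _ _ => Finset.sum_nonneg fun _ _ => mul_self_nonneg _

/-- The Golden–Thompson inequality for real symmetric matrices. -/
theorem trace_exp_add_le {A B : Matrix n n ℝ} (hA : Aᵀ = A) (hB : Bᵀ = B) :
    (NormedSpace.exp (A + B)).trace ≤ (NormedSpace.exp A * NormedSpace.exp B).trace := by
  cases isEmpty_or_nonempty n
  · simp [trace]
  -- The trace inequality is known for exponents `2 ^ k` only, so the Lie product limit is taken
  -- along that subsequence.
  have h1 := (tendsto_matrix_exp_mul_exp_pow A B).comp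
    (tendsto_pow_atTop_atTop_of_one_lt (one_lt_two : 1 < 2))
  have h2 : Tendsto (fun k : ℕ => ((NormedSpace.exp (((2 ^ k : ℕ) : ℝ)⁻¹ • A) *
      NormedSpace.exp (((2 ^ k : ℕ) : ℝ)⁻¹ • B)) ^ 2 ^ k).trace) atTop
      (𝓝 (NormedSpace.exp (A + B)).trace) :=
    ((continuous_id.matrix_trace).tendsto _).comp h1
  refine le_of_tendsto' h2 fun k => ?_
  have hpow : ∀ C : Matrix n n ℝ,
      NormedSpace.exp (((2 ^ k : ℕ) : ℝ)⁻¹ • C) ^ 2 ^ k = NormedSpace.exp C := fun C => by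
    rw [← Matrix.exp_nsmul, ← Nat.cast_smul_eq_nsmul ℝ, smul_smul, mul_inv_cancel₀ (by positivity),
      one_smul]
  have h3 := (abs_trace_pow_two_pow_le k).2 (NormedSpace.exp (((2 ^ k : ℕ) : ℝ)⁻¹ • A))
    (NormedSpace.exp (((2 ^ k : ℕ) : ℝ)⁻¹ • B)) (transpose_exp_eq (by rw [transpose_smul, hA]))
    (transpose_exp_eq (by rw [transpose_smul, hB]))
  rw [hpow, hpow, abs_of_nonneg (trace_exp_mul_exp_nonneg hA hB)] at h3
  exact (le_abs_self _).trans h3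

end GoldenThompson

/-! ### Spectral estimates for matrix exponentials. -/

section Spectral

variable {n : Type*} [Fintype n] [DecidableEq n]

lemma exists_orthogonal_diagonalization {A : Matrix n n ℝ} (hA : A.IsHermitian) :
    ∃ U : Matrix n n ℝ, Uᵀ * U = 1 ∧ U * Uᵀ = 1 ∧ A = U * diagonal hA.eigenvalues * Uᵀ := by
  refine ⟨hA.eigenvectorUnitary, ?_, ?_, ?_⟩
  · exact Unitary.coe_star_mul_self hA.eigenvectorUnitary
  · exact Unitary.coe_mul_star_self hA.eigenvectorUnitary
  · conv_lhs => rw [hA.spectral_theorem, Unitary.conjStarAlgAut_apply]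
    rfl

lemma exp_smul_conj_diagonal {U : Matrix n n ℝ} (hU : U * Uᵀ = 1) (v : n → ℝ) (s : ℝ) :
    NormedSpace.exp (s • (U * diagonal v * Uᵀ)) =
      U * diagonal (fun i => Real.exp (s * v i)) * Uᵀ := by
  have hinv : U⁻¹ = Uᵀ := Matrix.inv_eq_right_inv hU
  have hu : IsUnit U := IsUnit.of_mul_eq_one _ hU
  have h1 : s • (U * diagonal v * Uᵀ) = U * diagonal (s • v) * U⁻¹ := by
    rw [hinv, diagonal_smul, Matrix.mul_smul, Matrix.smul_mul]
  rw [h1, Matrix.exp_conj _ _ hu, hinv, exp_diagonal]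
  congr 3
  ext i
  rw [Pi.coe_exp, Real.exp_eq_exp_ℝ]
  rfl

omit [DecidableEq n] in
lemma dotProduct_conj_mulVec (U D : Matrix n n ℝ) (c : n → ℝ) :
    c ⬝ᵥ ((U * D * Uᵀ) *ᵥ c) = (Uᵀ *ᵥ c) ⬝ᵥ (D *ᵥ (Uᵀ *ᵥ c)) := by
  rw [← mulVec_mulVec, ← mulVec_mulVec, dotProduct_mulVec, ← mulVec_transpose]

lemma dotProduct_conj_diagonal_mulVec (U : Matrix n n ℝ) (v c : n → ℝ) :
    c ⬝ᵥ ((U * diagonal v * Uᵀ) *ᵥ c) = ∑ i, v i * (Uᵀ *ᵥ c) i ^ 2 := by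
  rw [dotProduct_conj_mulVec, dotProduct]
  refine Finset.sum_congr rfl fun i _ => ?_
  rw [mulVec_diagonal]
  ring

lemma dotProduct_self_eq_sum {U : Matrix n n ℝ} (hU : U * Uᵀ = 1) (c : n → ℝ) :
    c ⬝ᵥ c = ∑ i, (Uᵀ *ᵥ c) i ^ 2 := by
  have h := dotProduct_conj_diagonal_mulVec U 1 c
  simpa [hU] using h

/-- Follows from `(1 + x + x²/2)(1 - x + x²/2) = 1 + x⁴/4 ≥ 1`. The absence of an upper limit on `x`
is what makes second moments sufficient later. -/
lemma exp_neg_le_quadratic {x : ℝ} (hx : 0 ≤ x) : Real.exp (-x) ≤ 1 - x + x ^ 2 / 2 := by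
  have h1 := Real.quadratic_le_exp_of_nonneg hx
  have h2 : 0 ≤ 1 - x + x ^ 2 / 2 := by nlinarith [sq_nonneg (x - 1)]
  rw [Real.exp_neg, inv_le_iff_one_le_mul₀ (Real.exp_pos x)]
  nlinarith [mul_le_mul_of_nonneg_left h1 h2, sq_nonneg (x ^ 2)]

/-- The quadratic upper bound for the exponential of a negative semidefinite matrix. -/
lemma dotProduct_exp_neg_mulVec_le {A : Matrix n n ℝ} (hA : A.PosSemidef) {t : ℝ} (ht : 0 ≤ t)
    (c : n → ℝ) : c ⬝ᵥ (NormedSpace.exp (-t • A) *ᵥ c) ≤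
      c ⬝ᵥ c - t * (c ⬝ᵥ (A *ᵥ c)) + t ^ 2 / 2 * ((A *ᵥ c) ⬝ᵥ (A *ᵥ c)) := by
  obtain ⟨U, hU1, hU2, hUA⟩ := exists_orthogonal_diagonalization hA.1
  set v := hA.1.eigenvalues with hv
  have hv0 : ∀ i, 0 ≤ v i := hA.eigenvalues_nonneg
  clear_value v
  have h4 : (A *ᵥ c) ⬝ᵥ (A *ᵥ c) = ∑ i, v i ^ 2 * (Uᵀ *ᵥ c) i ^ 2 := by
    have h : Aᵀ = A := hA.1
    rw [dotProduct_mulVec, ← mulVec_transpose, h, mulVec_mulVec, dotProduct_comm,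
      ← dotProduct_conj_diagonal_mulVec]
    congr 2
    rw [hUA]
    calc _ = U * diagonal v * (Uᵀ * U) * diagonal v * Uᵀ := by simp only [mul_assoc]
      _ = _ := by
        rw [hU1, mul_one, mul_assoc U, diagonal_mul_diagonal]
        simp only [sq]
  rw [h4, dotProduct_self_eq_sum hU2 c]
  rw [hUA, exp_smul_conj_diagonal hU2, dotProduct_conj_diagonal_mulVec,
    dotProduct_conj_diagonal_mulVec, Finset.mul_sum, Finset.mul_sum, ← Finset.sum_sub_distrib,
    ← Finset.sum_add_distrib]
  refine Finset.sum_le_sum fun i _ => ?_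
  have h5 : Real.exp (-t * v i) ≤ 1 - t * v i + (t * v i) ^ 2 / 2 := by
    rw [neg_mul]
    exact exp_neg_le_quadratic (mul_nonneg ht (hv0 i))
  nlinarith [mul_le_mul_of_nonneg_right h5 (sq_nonneg ((Uᵀ *ᵥ c) i))]

lemma exp_smul_posSemidef {A : Matrix n n ℝ} (hA : A.IsHermitian) (s : ℝ) :
    (NormedSpace.exp (s • A)).PosSemidef := by
  obtain ⟨U, hU1, hU2, hUA⟩ := exists_orthogonal_diagonalization hA
  rw [hUA, exp_smul_conj_diagonal hU2]
  exact (PosSemidef.diagonal fun i => (Real.exp_pos _).le).mul_mul_conjTranspose_same U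

/-- A Rayleigh quotient at most `s` forces some eigenvalue to be at most `s`, and its exponential is
one of the positive terms of the trace. -/
lemma exp_neg_le_trace_exp {A : Matrix n n ℝ} (hA : A.IsHermitian) {t s : ℝ} (ht : 0 ≤ t)
    {c : n → ℝ} (hc : c ≠ 0) (hs : c ⬝ᵥ (A *ᵥ c) ≤ s * (c ⬝ᵥ c)) :
    Real.exp (-t * s) ≤ (NormedSpace.exp (-t • A)).trace := by
  obtain ⟨U, hU1, hU2, hUA⟩ := exists_orthogonal_diagonalization hA
  set v := hA.eigenvalues with hv
  clear_value v
  have hex : ∃ i, v i ≤ s := by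
    by_contra! h
    rw [hUA, dotProduct_conj_diagonal_mulVec, dotProduct_self_eq_sum hU2, Finset.mul_sum] at hs
    have h1 : ∀ i, (v i - s) * (Uᵀ *ᵥ c) i ^ 2 = 0 := by
      have h2 : ∑ i, (v i - s) * (Uᵀ *ᵥ c) i ^ 2 = 0 := by
        refine le_antisymm ?_ (Finset.sum_nonneg fun i _ =>
          mul_nonneg (sub_nonneg.mpr (h i).le) (sq_nonneg _))
        simp only [sub_mul, Finset.sum_sub_distrib]
        linarith
      intro i
      exact (Finset.sum_eq_zero_iff_of_nonneg fun i _ =>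
          mul_nonneg (sub_nonneg.mpr (h i).le) (sq_nonneg _)).mp h2 i (Finset.mem_univ i)
    have h3 : Uᵀ *ᵥ c = 0 := by
      ext i
      have := (mul_eq_zero.mp (h1 i)).resolve_left (sub_pos.mpr (h i)).ne'
      simpa using this
    apply hc
    have : c = U *ᵥ (Uᵀ *ᵥ c) := by rw [mulVec_mulVec, hU2, one_mulVec]
    rw [this, h3, mulVec_zero]
  obtain ⟨i, hi⟩ := hex
  rw [hUA, exp_smul_conj_diagonal hU2, trace_mul_comm, ← mul_assoc, hU1, one_mul, trace_diagonal]
  refine le_trans ?_ (Finset.single_le_sum (fun j _ => (Real.exp_pos (-t * v j)).le)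
    (Finset.mem_univ i))
  rw [Real.exp_le_exp]
  nlinarith

/-- The exponential is a contraction, so its entries are bounded. This supplies integrability of the
exponential without any bound on `A`. -/
lemma abs_exp_neg_apply_le_one {A : Matrix n n ℝ} (hA : A.PosSemidef) {t : ℝ} (ht : 0 ≤ t)
    (i j : n) : |NormedSpace.exp (-t • A) i j| ≤ 1 := by
  obtain ⟨U, hU1, hU2, hUA⟩ := exists_orthogonal_diagonalization hA.1
  set v := hA.1.eigenvalues with hv
  have hv0 : ∀ i, 0 ≤ v i := hA.eigenvalues_nonneg
  clear_value v
  have hdiag : ∀ i, ∑ k, U i k ^ 2 = 1 := fun i => by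
    have := congrFun (congrFun hU2 i) i
    simpa [mul_apply, sq] using this
  rw [hUA, exp_smul_conj_diagonal hU2, mul_apply]
  refine (Finset.abs_sum_le_sum_abs _ _).trans ?_
  have h : ∀ k, |(U * diagonal fun i => Real.exp (-t * v i)) i k * Uᵀ k j| ≤
      (U i k ^ 2 + U j k ^ 2) / 2 := fun k => by
    rw [mul_diagonal, transpose_apply, abs_mul, abs_mul, abs_of_pos (Real.exp_pos _)]
    have h1 : Real.exp (-t * v k) ≤ 1 := Real.exp_le_one_iff.mpr (by nlinarith [hv0 k])
    have h2 : |U i k| * Real.exp (-t * v k) ≤ |U i k| :=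
      mul_le_of_le_one_right (abs_nonneg _) h1
    nlinarith [mul_le_mul_of_nonneg_right h2 (abs_nonneg (U j k)), sq_nonneg (|U i k| - |U j k|),
      sq_abs (U i k), sq_abs (U j k)]
  refine (Finset.sum_le_sum fun k _ => h k).trans ?_
  rw [← Finset.sum_div, Finset.sum_add_distrib, hdiag, hdiag]
  norm_num

lemma trace_mul_nonneg {P Q : Matrix n n ℝ} (hP : P.PosSemidef) (hQ : Q.PosSemidef) :
    0 ≤ (P * Q).trace := by
  obtain ⟨U, hU1, hU2, hUA⟩ := exists_orthogonal_diagonalization hP.1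
  set v := hP.1.eigenvalues with hv
  have hv0 : ∀ i, 0 ≤ v i := hP.eigenvalues_nonneg
  clear_value v
  have h : (P * Q).trace = (diagonal v * (Uᴴ * Q * U)).trace := by
    rw [hUA, conjTranspose_eq_transpose_of_trivial, mul_assoc, mul_assoc, trace_mul_comm]
    simp only [mul_assoc]
  rw [h, trace]
  refine Finset.sum_nonneg fun i _ => ?_
  rw [diag_apply, diagonal_mul]
  exact mul_nonneg (hv0 i) ((hQ.conjTranspose_mul_mul_same U).diag_nonneg)

end Spectral

/-! ### The matrix Laplace transform and the lower tail bound. -/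

section Chernoff

variable {n : Type*} [Fintype n] [DecidableEq n]

lemma continuous_exp_apply (i j : n) :
    Continuous fun A : Matrix n n ℝ => NormedSpace.exp A i j := by
  let : NormedRing (Matrix n n ℝ) := Matrix.linftyOpNormedRing
  let : NormedAlgebra ℝ (Matrix n n ℝ) := Matrix.linftyOpNormedAlgebra
  let : NormedAlgebra ℚ (Matrix n n ℝ) := NormedAlgebra.restrictScalars ℚ ℝ _
  have hc := FiniteDimensional.complete ℝ (n → n → ℝ)
  exact (@NormedSpace.exp_continuous (Matrix n n ℝ) _ _ hc).matrix_elem i j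

lemma measurable_exp_smul_apply {E : Type*} [MeasurableSpace E] {A : E → Matrix n n ℝ}
    (hA : ∀ i j, Measurable fun e => A e i j) (s : ℝ) (i j : n) :
    Measurable fun e => NormedSpace.exp (s • A e) i j := by
  have h1 : Continuous fun B : n → n → ℝ => NormedSpace.exp (s • Matrix.of B) i j :=
    (continuous_exp_apply i j).comp (continuous_matrix fun k l => by
      simp only [Matrix.smul_apply, of_apply]
      fun_prop)
  have h2 : Measurable fun e => fun i j => A e i j :=
    measurable_pi_lambda _ fun i => measurable_pi_lambda _ fun j => hA i j
  exact h1.measurable.comp h2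

variable {Ω : Type*} [MeasurableSpace Ω] {P : Measure Ω}

omit [DecidableEq n] in
lemma integral_dotProduct_mulVec {V : Ω → Matrix n n ℝ}
    (hV : ∀ i j, Integrable (fun ω => V ω i j) P) (c : n → ℝ) :
    ∫ ω, c ⬝ᵥ (V ω *ᵥ c) ∂P = c ⬝ᵥ ((Matrix.of fun i j => ∫ ω, V ω i j ∂P) *ᵥ c) := by
  simp only [dotProduct, mulVec, Finset.mul_sum]
  rw [integral_finsetSum _ fun i _ => integrable_finsetSum _ fun j _ =>
    ((hV i j).mul_const _).const_mul _]
  refine Finset.sum_congr rfl fun i _ => ?_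
  rw [integral_finsetSum _ fun j _ => ((hV i j).mul_const _).const_mul _]
  refine Finset.sum_congr rfl fun j _ => ?_
  rw [integral_const_mul, integral_mul_const]
  rfl

variable [IsProbabilityMeasure P]

lemma integrable_exp_neg_apply {A : Ω → Matrix n n ℝ} (hm : ∀ i j, Measurable fun ω => A ω i j)
    (hA : ∀ ω, (A ω).PosSemidef) {t : ℝ} (ht : 0 ≤ t) (i j : n) :
    Integrable (fun ω => NormedSpace.exp (-t • A ω) i j) P :=
  Integrable.of_bound (measurable_exp_smul_apply hm _ i j).aestronglyMeasurable 1
    (Eventually.of_forall fun ω => abs_exp_neg_apply_le_one (hA ω) ht i j)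

lemma integrable_trace_exp_neg {A : Ω → Matrix n n ℝ} (hm : ∀ i j, Measurable fun ω => A ω i j)
    (hA : ∀ ω, (A ω).PosSemidef) {t : ℝ} (ht : 0 ≤ t) :
    Integrable (fun ω => (NormedSpace.exp (-t • A ω)).trace) P :=
  integrable_finsetSum _ fun i _ => integrable_exp_neg_apply hm hA ht i i

/-- One step of the matrix Laplace transform method: the factor contributed by an independent
positive semidefinite summand. -/
lemma integral_trace_exp_neg_add_le {A B : Ω → Matrix n n ℝ}
    (hmA : ∀ i j, Measurable fun ω => A ω i j) (hmB : ∀ i j, Measurable fun ω => B ω i j)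
    (hA : ∀ ω, (A ω).PosSemidef) (hB : ∀ ω, (B ω).PosSemidef)
    {t : ℝ} (ht : 0 ≤ t) {s : ℝ}
    (hind : ∀ i j k l, IndepFun (fun ω => NormedSpace.exp (-t • A ω) i j)
      (fun ω => NormedSpace.exp (-t • B ω) k l) P)
    (hi1 : ∀ c, Integrable (fun ω => c ⬝ᵥ (B ω *ᵥ c)) P)
    (hi2 : ∀ c, Integrable (fun ω => (B ω *ᵥ c) ⬝ᵥ (B ω *ᵥ c)) P)
    (hlow : ∀ c, c ⬝ᵥ c ≤ ∫ ω, c ⬝ᵥ (B ω *ᵥ c) ∂P)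
    (hup : ∀ c, ∫ ω, (B ω *ᵥ c) ⬝ᵥ (B ω *ᵥ c) ∂P ≤ s * (c ⬝ᵥ c)) :
    ∫ ω, (NormedSpace.exp (-t • (A ω + B ω))).trace ∂P ≤
      Real.exp (-t + t ^ 2 / 2 * s) * ∫ ω, (NormedSpace.exp (-t • A ω)).trace ∂P := by
  have hWi := integrable_exp_neg_apply (P := P) hmA hA ht
  have hVi := integrable_exp_neg_apply (P := P) hmB hB ht
  set EW : Matrix n n ℝ := Matrix.of fun i j => ∫ ω, NormedSpace.exp (-t • A ω) i j ∂P with hEW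
  set EV : Matrix n n ℝ := Matrix.of fun i j => ∫ ω, NormedSpace.exp (-t • B ω) i j ∂P with hEV
  have hsymm : ∀ C : Ω → Matrix n n ℝ, (∀ ω, (C ω).PosSemidef) →
      (Matrix.of fun i j => ∫ ω, NormedSpace.exp (-t • C ω) i j ∂P).IsHermitian := by
    intro C hC
    ext i j
    simp only [conjTranspose_apply, of_apply, star_trivial]
    congr 1
    ext ω
    exact (exp_smul_posSemidef (hC ω).1 (-t)).1.apply i j
  have hEWp : EW.PosSemidef := by
    refine PosSemidef.of_dotProduct_mulVec_nonneg (hsymm A hA) fun c => ?_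
    rw [star_trivial, hEW, ← integral_dotProduct_mulVec hWi]
    exact integral_nonneg fun ω => by
      simpa using (exp_smul_posSemidef (hA ω).1 (-t)).dotProduct_mulVec_nonneg c
  set r := Real.exp (-t + t ^ 2 / 2 * s) with hr
  -- Integrating the quadratic bound gives `E exp(-tB) ≤ (1 - t + t² s/2) · 1` in the semidefinite
  -- order, and `1 + u ≤ exp u` turns the scalar into `r`.
  have hEVp : (r • (1 : Matrix n n ℝ) - EV).PosSemidef := by
    refine PosSemidef.of_dotProduct_mulVec_nonneg ?_ fun c => ?_
    · exact (isHermitian_one.smul (by simp [IsSelfAdjoint])).sub (hsymm B hB)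
    rw [star_trivial, sub_mulVec, dotProduct_sub, smul_mulVec, one_mulVec, dotProduct_smul,
      sub_nonneg, hEV, ← integral_dotProduct_mulVec hVi, smul_eq_mul]
    have hVc : Integrable (fun ω => c ⬝ᵥ (NormedSpace.exp (-t • B ω) *ᵥ c)) P := by
      simp only [dotProduct, mulVec, Finset.mul_sum]
      exact integrable_finsetSum _ fun i _ => integrable_finsetSum _ fun j _ =>
        ((hVi i j).mul_const _).const_mul _
    have hleft : Integrable (fun ω => c ⬝ᵥ c - t * (c ⬝ᵥ (B ω *ᵥ c))) P :=
      (integrable_const _).sub ((hi1 c).const_mul _)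
    have hright : Integrable (fun ω => c ⬝ᵥ c - t * (c ⬝ᵥ (B ω *ᵥ c)) +
        t ^ 2 / 2 * ((B ω *ᵥ c) ⬝ᵥ (B ω *ᵥ c))) P :=
      hleft.add ((hi2 c).const_mul _)
    have hcc : 0 ≤ c ⬝ᵥ c := Finset.sum_nonneg fun i _ => mul_self_nonneg (c i)
    calc ∫ ω, c ⬝ᵥ (NormedSpace.exp (-t • B ω) *ᵥ c) ∂P
        ≤ ∫ ω, (c ⬝ᵥ c - t * (c ⬝ᵥ (B ω *ᵥ c)) +
          t ^ 2 / 2 * ((B ω *ᵥ c) ⬝ᵥ (B ω *ᵥ c))) ∂P :=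
          integral_mono hVc hright fun ω => dotProduct_exp_neg_mulVec_le (hB ω) ht c
      _ = c ⬝ᵥ c - t * ∫ ω, c ⬝ᵥ (B ω *ᵥ c) ∂P +
          t ^ 2 / 2 * ∫ ω, (B ω *ᵥ c) ⬝ᵥ (B ω *ᵥ c) ∂P := by
          rw [integral_add hleft ((hi2 c).const_mul _), integral_sub (integrable_const _) ((hi1 c).const_mul _), integral_const_mul,
            integral_const_mul]
          simp
      _ ≤ (1 + (-t + t ^ 2 / 2 * s)) * (c ⬝ᵥ c) := by
          have h1 := mul_le_mul_of_nonneg_left (hlow c) ht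
          have h2 := mul_le_mul_of_nonneg_left (hup c) (by positivity : 0 ≤ t ^ 2 / 2)
          linarith
      _ ≤ r * (c ⬝ᵥ c) := by
          gcongr
          rw [add_comm]
          exact Real.add_one_le_exp _
  have hprod : ∀ i j, Integrable (fun ω => NormedSpace.exp (-t • A ω) i j *
      NormedSpace.exp (-t • B ω) j i) P := fun i j =>
    (hind i j j i).integrable_mul (hWi i j) (hVi j i)
  calc ∫ ω, (NormedSpace.exp (-t • (A ω + B ω))).trace ∂P
      ≤ ∫ ω, (NormedSpace.exp (-t • A ω) * NormedSpace.exp (-t • B ω)).trace ∂P := by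
        refine integral_mono_of_nonneg (Eventually.of_forall fun ω => ?_) ?_
          (Eventually.of_forall fun ω => ?_)
        · exact (exp_smul_posSemidef ((hA ω).add (hB ω)).1 (-t)).trace_nonneg
        · simp only [trace, diag_apply, mul_apply]
          exact integrable_finsetSum _ fun i _ => integrable_finsetSum _ fun j _ => hprod i j
        · have h1 : (-t • A ω)ᵀ = -t • A ω := by
            rw [transpose_smul]; congr 1; exact (hA ω).1
          have h2 : (-t • B ω)ᵀ = -t • B ω := by
            rw [transpose_smul]; congr 1; exact (hB ω).1
          simp only [smul_add]
          exact trace_exp_add_le h1 h2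
    -- Entrywise independence lets the expectation pass to each factor of the product.
    _ = (EW * EV).trace := by
        simp only [trace, diag_apply, mul_apply]
        rw [integral_finsetSum _ fun i _ => integrable_finsetSum _ fun j _ => hprod i j]
        refine Finset.sum_congr rfl fun i _ => ?_
        rw [integral_finsetSum _ fun j _ => hprod i j]
        refine Finset.sum_congr rfl fun j _ => ?_
        exact (hind i j j i).integral_fun_mul_eq_mul_integral (hWi i j).1 (hVi j i).1
    _ ≤ r * EW.trace := by
        have := trace_mul_nonneg hEWp hEVp
        rw [mul_sub, trace_sub, mul_smul_comm, mul_one, trace_smul, smul_eq_mul] at this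
        linarith
    _ = r * ∫ ω, (NormedSpace.exp (-t • A ω)).trace ∂P := by
        congr 1
        simp only [trace, diag_apply]
        rw [integral_finsetSum _ fun i _ => hWi i i]
        rfl

variable {ι E : Type*} [MeasurableSpace E]

lemma integral_trace_exp_neg_sum_le {X : ι → Ω → E} (hX : ∀ l, Measurable (X l))
    (hind : iIndepFun X P) {M : E → Matrix n n ℝ} (hM : ∀ i j, Measurable fun e => M e i j)
    (hpsd : ∀ e, (M e).PosSemidef) {t : ℝ} (ht : 0 ≤ t) {s : ℝ}
    (hi1 : ∀ l c, Integrable (fun ω => c ⬝ᵥ (M (X l ω) *ᵥ c)) P)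
    (hi2 : ∀ l c, Integrable (fun ω => (M (X l ω) *ᵥ c) ⬝ᵥ (M (X l ω) *ᵥ c)) P)
    (hlow : ∀ l c, c ⬝ᵥ c ≤ ∫ ω, c ⬝ᵥ (M (X l ω) *ᵥ c) ∂P)
    (hup : ∀ l c, ∫ ω, (M (X l ω) *ᵥ c) ⬝ᵥ (M (X l ω) *ᵥ c) ∂P ≤ s * (c ⬝ᵥ c))
    (T : Finset ι) :
    ∫ ω, (NormedSpace.exp (-t • ∑ l ∈ T, M (X l ω))).trace ∂P ≤
      Fintype.card n * Real.exp (T.card * (-t + t ^ 2 / 2 * s)) := by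
  classical
  induction T using Finset.induction_on with
  | empty => simp
  | insert a T ha ih =>
    have hmA : ∀ i j, Measurable fun e : T → E => (∑ l : T, M (e l)) i j := fun i j => by
      simp only [Matrix.sum_apply]
      exact Finset.measurable_sum _ fun l _ => (hM i j).comp (measurable_pi_apply l)
    -- Summing over the subtype exhibits the partial sum as a function of the subfamily indexed by
    -- `T`, which is independent of the one indexed by `{a}`.
    have hsum : ∀ ω, ∑ l ∈ T, M (X l ω) = ∑ l : T, M (X l ω) := fun ω =>
      (Finset.sum_coe_sort T fun l => M (X l ω)).symm
    have hXT : Measurable fun ω => fun l : T => X l ω :=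
      measurable_pi_lambda _ fun l => hX l
    have h0 := hind.indepFun_finset T {a} (by simpa using ha) hX
    have hstep := integral_trace_exp_neg_add_le (P := P) (A := fun ω => ∑ l ∈ T, M (X l ω))
      (B := fun ω => M (X a ω)) (t := t) (s := s) (fun i j => by
        simp only [hsum]
        exact (hmA i j).comp hXT) (fun i j => (hM i j).comp (hX a))
      (fun ω => posSemidef_sum _ fun l _ => hpsd _) (fun ω => hpsd _) ht (fun i j k l => by
        simp only [hsum]
        exact h0.comp (measurable_exp_smul_apply hmA (-t) i j)
          ((measurable_exp_smul_apply hM (-t) k l).comp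
            (measurable_pi_apply (⟨a, by simp⟩ : ({a} : Finset ι)))))
      (hi1 a) (hi2 a) (hlow a) (hup a)
    have hrw : ∀ ω, ∑ l ∈ insert a T, M (X l ω) = ∑ l ∈ T, M (X l ω) + M (X a ω) := fun ω => by
      rw [Finset.sum_insert ha, add_comm]
    simp only [hrw]
    refine hstep.trans ((mul_le_mul_of_nonneg_left ih (Real.exp_pos _).le).trans (le_of_eq ?_))
    rw [Finset.card_insert_of_notMem ha, mul_left_comm, ← Real.exp_add]
    push_cast
    ring_nf

/-- A lower tail bound for sums of independent positive semidefinite random matrices whose means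
dominate the identity. -/
theorem measure_exists_dotProduct_sum_mulVec_le [Fintype ι] {X : ι → Ω → E}
    (hX : ∀ l, Measurable (X l))
    (hind : iIndepFun X P) {M : E → Matrix n n ℝ} (hM : ∀ i j, Measurable fun e => M e i j)
    (hpsd : ∀ e, (M e).PosSemidef) {s : ℝ} (hs : 0 < s)
    (hi1 : ∀ l c, Integrable (fun ω => c ⬝ᵥ (M (X l ω) *ᵥ c)) P)
    (hi2 : ∀ l c, Integrable (fun ω => (M (X l ω) *ᵥ c) ⬝ᵥ (M (X l ω) *ᵥ c)) P)
    (hlow : ∀ l c, c ⬝ᵥ c ≤ ∫ ω, c ⬝ᵥ (M (X l ω) *ᵥ c) ∂P)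
    (hup : ∀ l c, ∫ ω, (M (X l ω) *ᵥ c) ⬝ᵥ (M (X l ω) *ᵥ c) ∂P ≤ s * (c ⬝ᵥ c))
    {δ : ℝ} (hδ : 0 ≤ δ) :
    P.real {ω | ∃ c : n → ℝ, c ≠ 0 ∧
        c ⬝ᵥ ((∑ l, M (X l ω)) *ᵥ c) ≤ (1 - δ) * Fintype.card ι * (c ⬝ᵥ c)} ≤
      Fintype.card n * Real.exp (-(Fintype.card ι * δ ^ 2 / (2 * s))) := by
  -- This `t` minimises the exponent `-tδ + t² s/2` left after Markov's inequality.
  set t := δ / s with htd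
  have ht : 0 ≤ t := by positivity
  have hbound := integral_trace_exp_neg_sum_le hX hind hM hpsd ht hi1 hi2 hlow hup Finset.univ
  rw [Finset.card_univ] at hbound
  set N : ℝ := (Fintype.card ι : ℝ)
  have hpsdS : ∀ ω, (∑ l, M (X l ω)).PosSemidef := fun ω => posSemidef_sum _ fun l _ => hpsd _
  have hmS : ∀ i j, Measurable fun ω => (∑ l, M (X l ω)) i j := fun i j => by
    simp only [Matrix.sum_apply]
    exact Finset.measurable_sum _ fun l _ => (hM i j).comp (hX l)
  have hmarkov := mul_meas_ge_le_integral_of_nonneg (μ := P)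
    (f := fun ω => (NormedSpace.exp (-t • ∑ l, M (X l ω))).trace)
    (Eventually.of_forall fun ω => (exp_smul_posSemidef (hpsdS ω).1 (-t)).trace_nonneg)
    (integrable_trace_exp_neg hmS hpsdS ht) (Real.exp (-t * ((1 - δ) * N)))
  have hsub : {ω | ∃ c : n → ℝ, c ≠ 0 ∧
      c ⬝ᵥ ((∑ l, M (X l ω)) *ᵥ c) ≤ (1 - δ) * N * (c ⬝ᵥ c)} ⊆
      {ω | Real.exp (-t * ((1 - δ) * N)) ≤ (NormedSpace.exp (-t • ∑ l, M (X l ω))).trace} := by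
    rintro ω ⟨c, hc, hle⟩
    exact exp_neg_le_trace_exp (hpsdS ω).1 ht hc hle
  have h1 := (mul_le_mul_of_nonneg_left (measureReal_mono (μ := P) hsub)
    (Real.exp_pos (-t * ((1 - δ) * N))).le).trans (hmarkov.trans hbound)
  rw [← le_div_iff₀' (Real.exp_pos _), mul_div_assoc, ← Real.exp_sub] at h1
  refine h1.trans (le_of_eq ?_)
  congr 2
  rw [htd]
  field_simp
  ring

end Chernoff

/-! ### Fourier sums and the measurements on the tangent space. -/

section Fourier

variable {d : ℕ}

lemma norm_exp_two_pi_I_div (d : ℕ) : ‖Complex.exp (2 * Real.pi * Complex.I / d)‖ = 1 := by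
  have h : 2 * Real.pi * Complex.I / d = ((2 * Real.pi / d : ℝ) : ℂ) * Complex.I := by
    push_cast
    ring
  rw [h, Complex.norm_exp_ofReal_mul_I]

lemma norm_fourierVec (k j : Fin d) : ‖fourierVec k j‖ = 1 := by
  rw [fourierVec, norm_pow, norm_exp_two_pi_I_div, one_pow]

/-- Coprimality keeps `ζ ^ m` a primitive `d`-th root of unity, so this is a full geometric sum. The
case `m = 1` gives Parseval; the case `m = 2` is where the oddness of `d` enters. -/
lemma sum_fourierVec_mul_star_pow {m : ℕ} (hm : m.Coprime d) (i j : Fin d) :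
    ∑ k, (fourierVec k i * star (fourierVec k j)) ^ m = if i = j then (d : ℂ) else 0 := by
  have hd : d ≠ 0 := fun h => (h ▸ i).elim0
  set ζ := Complex.exp (2 * Real.pi * Complex.I / d) with hζd
  have hζ : IsPrimitiveRoot ζ d := Complex.isPrimitiveRoot_exp d hd
  have hξ := hζ.pow_of_coprime m hm
  have hnorm : ‖ζ‖ = 1 := norm_exp_two_pi_I_div d
  have hstar : ζ * star ζ = 1 := by
    rw [Complex.star_def, Complex.mul_conj, Complex.normSq_eq_norm_sq, hnorm]
    norm_num
  set u := (ζ ^ m) ^ ((i : ℕ) + 1) * star ((ζ ^ m) ^ ((j : ℕ) + 1)) with hu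
  -- The extra factor `u` reflects that the frequencies run over `1, …, d`.
  have hterm : ∀ k : Fin d, (fourierVec k i * star (fourierVec k j)) ^ m = u * u ^ (k : ℕ) := by
    intro k
    rw [fourierVec, fourierVec, ← pow_succ', hu, ← hζd]
    simp only [star_pow, mul_pow, ← pow_mul]
    congr 2 <;> ring
  simp only [hterm]
  split_ifs with hij
  · have hu1 : u = 1 := by
      rw [hu, hij, star_pow, star_pow, ← mul_pow, ← mul_pow, hstar, one_pow, one_pow]
    simp [hu1]
  · have hune : u ≠ 1 := by
      intro h
      apply hij
      have hpos : star ((ζ ^ m) ^ ((j : ℕ) + 1)) * (ζ ^ m) ^ ((j : ℕ) + 1) = 1 := by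
        rw [star_pow, star_pow, ← mul_pow, ← mul_pow, mul_comm, hstar, one_pow, one_pow]
      have h1 : (ζ ^ m) ^ ((i : ℕ) + 1) = (ζ ^ m) ^ ((j : ℕ) + 1) := by
        calc (ζ ^ m) ^ ((i : ℕ) + 1) = u * (ζ ^ m) ^ ((j : ℕ) + 1) := by
              rw [hu, mul_assoc, hpos, mul_one]
          _ = _ := by rw [h, one_mul]
      have hne : ζ ^ m ≠ 0 := hξ.ne_zero hd
      rw [pow_succ, pow_succ] at h1
      exact Fin.ext (hξ.pow_inj i.2 j.2 (mul_right_cancel₀ hne h1))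
    have hud : u ^ d = 1 := by
      have h : ∀ r, ((ζ ^ m) ^ r) ^ d = 1 := fun r => by
        rw [← pow_mul, mul_comm, pow_mul, hξ.pow_eq_one, one_pow]
      rw [hu, mul_pow, ← star_pow, h, h]
      simp
    rw [← Finset.mul_sum, Fin.sum_univ_eq_sum_range (fun k => u ^ k)]
    have := geom_sum_mul u d
    rw [hud, sub_self] at this
    rw [(mul_eq_zero.mp this).resolve_right (sub_ne_zero.mpr hune), mul_zero]

lemma sum_norm_sq_fourier (v : Fin d → ℂ) :
    ∑ k, ‖∑ j, star (fourierVec k j) * v j‖ ^ 2 = d * ∑ j, ‖v j‖ ^ 2 := by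
  have h : ∀ k, ((‖∑ j, star (fourierVec k j) * v j‖ ^ 2 : ℝ) : ℂ) =
      ∑ i, ∑ j, (fourierVec k i * star (fourierVec k j)) ^ 1 * (star (v i) * v j) := by
    intro k
    rw [← Complex.normSq_eq_norm_sq, ← Complex.mul_conj, mul_comm, map_sum, Finset.sum_mul_sum]
    refine Finset.sum_congr rfl fun i _ => Finset.sum_congr rfl fun j _ => ?_
    simp only [Complex.star_def, map_mul, Complex.conj_conj]
    ring
  have h2 : ((∑ k, ‖∑ j, star (fourierVec k j) * v j‖ ^ 2 : ℝ) : ℂ) =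
      ((d * ∑ j, ‖v j‖ ^ 2 : ℝ) : ℂ) := by
    rw [Complex.ofReal_sum]
    simp only [h]
    rw [Finset.sum_comm]
    push_cast
    rw [Finset.mul_sum]
    refine Finset.sum_congr rfl fun i _ => ?_
    rw [Finset.sum_comm]
    simp only [← Finset.sum_mul, sum_fourierVec_mul_star_pow (Nat.coprime_one_left d)]
    simp only [ite_mul, zero_mul, Finset.sum_ite_eq, Finset.mem_univ, if_true]
    rw [Complex.star_def, Complex.conj_mul']
  exact_mod_cast h2

/-- The inner product of the modulated Fourier vector `D f_k` with `v`. -/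
noncomputable def amplitude (a : Fin d → ℝ) (k : Fin d) (v : Fin d → ℂ) : ℂ :=
  ∑ i, star (fourierVec k i) * (a i * v i)

lemma sum_norm_sq_amplitude (a : Fin d → ℝ) (v : Fin d → ℂ) :
    ∑ k, ‖amplitude a k v‖ ^ 2 = d * ∑ j, (a j) ^ 2 * ‖v j‖ ^ 2 := by
  simp only [amplitude]
  rw [sum_norm_sq_fourier]
  simp [mul_pow]

lemma sum_norm_sq_amplitude_le {a : Fin d → ℝ} {b : ℝ} (ha : ∀ i, |a i| ≤ b) (v : Fin d → ℂ) :
    ∑ k, ‖amplitude a k v‖ ^ 2 ≤ d * (b ^ 2 * ∑ j, ‖v j‖ ^ 2) := by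
  rw [sum_norm_sq_amplitude]
  refine mul_le_mul_of_nonneg_left ?_ (Nat.cast_nonneg d)
  rw [Finset.mul_sum]
  refine Finset.sum_le_sum fun j _ => ?_
  exact mul_le_mul_of_nonneg_right (sq_le_sq' (abs_le.mp (ha j)).1 (abs_le.mp (ha j)).2)
    (sq_nonneg _)

lemma measurementMatrix_apply (a : Fin d → ℝ) (k i j : Fin d) :
    measurementMatrix a k i j = a i * fourierVec k i * star (fourierVec k j) * a j := by
  rw [measurementMatrix, maskMatrix, mul_diagonal, diagonal_mul, vecMulVec_apply, Pi.star_apply]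
  ring

lemma trace_measurementMatrix_mul (a : Fin d → ℝ) (k : Fin d) (Z : Matrix (Fin d) (Fin d) ℂ) :
    (measurementMatrix a k * Z).trace =
      ∑ i, ∑ j, ((a i * a j : ℝ) : ℂ) * (fourierVec k j * star (fourierVec k i) * Z i j) := by
  rw [trace, Finset.sum_comm]
  refine Finset.sum_congr rfl fun j _ => ?_
  rw [diag_apply, mul_apply]
  refine Finset.sum_congr rfl fun i _ => ?_
  rw [measurementMatrix_apply]
  push_cast
  ring

lemma trace_measurementMatrix_mul_tangent (a : Fin d → ℝ) (k : Fin d) (x z : Fin d → ℂ) :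
    (measurementMatrix a k * (vecMulVec x (star z) + vecMulVec z (star x))).trace =
      ((2 * (amplitude a k x * star (amplitude a k z)).re : ℝ) : ℂ) := by
  have h : ∀ v w : Fin d → ℂ, (measurementMatrix a k * vecMulVec v (star w)).trace =
      amplitude a k v * star (amplitude a k w) := by
    intro v w
    rw [trace_measurementMatrix_mul, amplitude, amplitude, star_sum, Finset.sum_mul_sum]
    refine Finset.sum_congr rfl fun i _ => Finset.sum_congr rfl fun j _ => ?_
    rw [vecMulVec_apply, Pi.star_apply]
    simp only [Complex.star_def, map_mul, Complex.conj_conj, Complex.conj_ofReal]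
    push_cast
    ring
  rw [mul_add, trace_add, h, h]
  have h2 := Complex.add_conj (amplitude a k x * star (amplitude a k z))
  simp only [Complex.star_def, map_mul, Complex.conj_conj] at h2 ⊢
  rw [mul_comm (amplitude a k z), h2]

end Fourier

/-! ### Fourth moments of the mask entries and of quadratic forms in them. -/

section Moments

variable {Ω ι : Type*} [MeasurableSpace Ω] {P : Measure Ω} [IsProbabilityMeasure P]
  [Fintype ι] {X : ι → Ω → ℝ} {b ν : ℝ}

/-- Almost surely the vector lies in a compact cube, on which `g` is bounded. Most integrability
claims below come from this. -/
lemma integrable_continuous_comp_of_bounded (hX : ∀ i, Measurable (X i))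
    (hb : ∀ i, ∀ᵐ ω ∂P, |X i ω| ≤ b) {g : (ι → ℝ) → ℝ} (hg : Continuous g) :
    Integrable (fun ω => g fun i => X i ω) P := by
  have hK : IsCompact (Set.univ.pi fun _ : ι => Set.Icc (-b) b) :=
    isCompact_univ_pi fun _ => isCompact_Icc
  obtain ⟨C, hC⟩ := hK.exists_bound_of_continuousOn hg.continuousOn
  refine Integrable.of_bound
    (hg.measurable.comp (measurable_pi_lambda _ hX)).aestronglyMeasurable C ?_
  filter_upwards [ae_all_iff.mpr hb] with ω hω
  exact hC _ fun i _ => abs_le.mp (hω i)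

variable [DecidableEq ι]

-- By independence the expectation factors over the indices; an index `q` of multiplicity one or
-- three contributes a vanishing first or third moment.
omit [IsProbabilityMeasure P] in
lemma integral_mul_four_eq_zero (hX : ∀ i, Measurable (X i)) (hind : iIndepFun X P)
    (h1 : ∀ i, ∫ ω, X i ω ∂P = 0) (h3 : ∀ i, ∫ ω, X i ω ^ 3 ∂P = 0) {i j k l : ι} (q : ι)
    (hq : ((if q = i then 1 else 0) + (if q = j then 1 else 0) + (if q = k then 1 else 0) +
      (if q = l then 1 else 0) : ℕ) = 1 ∨ ((if q = i then 1 else 0) + (if q = j then 1 else 0) +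
      (if q = k then 1 else 0) + (if q = l then 1 else 0) : ℕ) = 3) :
    ∫ ω, X i ω * X j ω * X k ω * X l ω ∂P = 0 := by
  set c : ι → ℕ := fun q => (if q = i then 1 else 0) + (if q = j then 1 else 0) +
    (if q = k then 1 else 0) + (if q = l then 1 else 0) with hc
  have h : ∀ ω, X i ω * X j ω * X k ω * X l ω = ∏ p, X p ω ^ c p := fun ω => by
    simp only [hc, pow_add, Finset.prod_mul_distrib, pow_ite, pow_one, pow_zero,
      Finset.prod_ite_eq', Finset.mem_univ, if_true]
  simp only [h]
  rw [hind.integral_fun_prod_comp (f := fun p y => y ^ c p) (fun p => (hX p).aemeasurable)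
    fun p => (by fun_prop : Measurable fun y : ℝ => y ^ c p).aestronglyMeasurable]
  refine Finset.prod_eq_zero (Finset.mem_univ q) ?_
  rcases hq with hq | hq
  · change c q = 1 at hq
    simp [hq, h1]
  · change c q = 3 at hq
    simp [hq, h3]

omit [IsProbabilityMeasure P] [Fintype ι] [DecidableEq ι] in
lemma integral_sq_mul_sq (hX : ∀ i, Measurable (X i)) (hind : iIndepFun X P)
    (h2 : ∀ i, ∫ ω, X i ω ^ 2 ∂P = ν) {i j : ι} (hij : i ≠ j) :
    ∫ ω, X i ω ^ 2 * X j ω ^ 2 ∂P = ν ^ 2 := by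
  have hm : Measurable fun y : ℝ => y ^ 2 := by fun_prop
  have h := ((hind.indepFun hij).comp hm hm).integral_fun_mul_eq_mul_integral
    (hm.comp (hX i)).aestronglyMeasurable (hm.comp (hX j)).aestronglyMeasurable
  simp only [Function.comp_apply, h2] at h
  rw [h, sq]

omit [IsProbabilityMeasure P] in
/-- The mixed fourth moments of independent variables whose fourth moment is twice the square of
the second one. -/
lemma integral_mul_four (hX : ∀ i, Measurable (X i)) (hind : iIndepFun X P)
    (h1 : ∀ i, ∫ ω, X i ω ∂P = 0) (h2 : ∀ i, ∫ ω, X i ω ^ 2 ∂P = ν)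
    (h3 : ∀ i, ∫ ω, X i ω ^ 3 ∂P = 0) (h4 : ∀ i, ∫ ω, X i ω ^ 4 ∂P = 2 * ν ^ 2) (i j k l : ι) :
    ∫ ω, X i ω * X j ω * X k ω * X l ω ∂P =
      ν ^ 2 * ((if i = j then if k = l then 1 else 0 else 0) +
        (if i = k then if j = l then 1 else 0 else 0) +
        (if i = l then if j = k then 1 else 0 else 0) -
        (if i = j then if i = k then if i = l then 1 else 0 else 0 else 0)) := by
  by_cases hij : i = j
  · subst hij
    by_cases hkl : k = l
    · subst hkl
      by_cases hik : i = k
      · subst hik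
        simp only [if_true]
        calc _ = ∫ ω, X i ω ^ 4 ∂P := by congr 1; ext ω; ring
          _ = _ := by rw [h4]; ring
      · simp only [hik, if_true, if_false]
        calc _ = ∫ ω, X i ω ^ 2 * X k ω ^ 2 ∂P := by congr 1; ext ω; ring
          _ = _ := by rw [integral_sq_mul_sq hX hind h2 hik]; ring
    · rw [integral_mul_four_eq_zero hX hind h1 h3 k]
      · by_cases hik : i = k
        · subst hik; simp [hkl]
        · simp [hkl, hik]
      · by_cases hik : i = k
        · subst hik; simp [hkl]
        · simp [hkl, Ne.symm hik]
  · by_cases hik : i = k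
    · subst hik
      by_cases hjl : j = l
      · subst hjl
        simp only [hij, Ne.symm hij, if_true, if_false]
        calc _ = ∫ ω, X i ω ^ 2 * X j ω ^ 2 ∂P := by congr 1; ext ω; ring
          _ = _ := by rw [integral_sq_mul_sq hX hind h2 hij]; ring
      · rw [integral_mul_four_eq_zero hX hind h1 h3 j]
        · simp [hij, Ne.symm hij, hjl]
        · simp [Ne.symm hij, hjl]
    · by_cases hil : i = l
      · subst hil
        by_cases hjk : j = k
        · subst hjk
          simp only [hij, Ne.symm hij, if_true, if_false]
          calc _ = ∫ ω, X i ω ^ 2 * X j ω ^ 2 ∂P := by congr 1; ext ω; ring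
            _ = _ := by rw [integral_sq_mul_sq hX hind h2 hij]; ring
        · rw [integral_mul_four_eq_zero hX hind h1 h3 j]
          · simp [hij, hik, hjk]
          · simp [Ne.symm hij, hjk]
      · rw [integral_mul_four_eq_zero hX hind h1 h3 i]
        · simp [hij, hik, hil]
        · simp [hij, hik, hil]

lemma norm_sum_sum_sq {κ : Type*} [Fintype κ] (y : κ → κ → ℝ) (w : κ → κ → ℂ) :
    ‖∑ i, ∑ j, (y i j : ℂ) * w i j‖ ^ 2 =
      ∑ i, ∑ j, ∑ k, ∑ l, y i j * y k l * (w i j * star (w k l)).re := by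
  have h : ((‖∑ i, ∑ j, (y i j : ℂ) * w i j‖ ^ 2 : ℝ) : ℂ) =
      ∑ i, ∑ j, ∑ k, ∑ l, ((y i j * y k l : ℝ) : ℂ) * (w i j * star (w k l)) := by
    rw [← Complex.normSq_eq_norm_sq, ← Complex.mul_conj, map_sum, Finset.sum_mul]
    refine Finset.sum_congr rfl fun i _ => ?_
    rw [Finset.sum_mul]
    refine Finset.sum_congr rfl fun j _ => ?_
    rw [Finset.mul_sum]
    refine Finset.sum_congr rfl fun k _ => ?_
    rw [map_sum, Finset.mul_sum]
    refine Finset.sum_congr rfl fun l _ => ?_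
    simp only [Complex.star_def, map_mul, Complex.conj_ofReal]
    push_cast
    ring
  have h2 := congrArg Complex.re h
  simpa only [Complex.ofReal_re, Complex.re_sum, Complex.re_ofReal_mul] using h2

/-- The first three terms come from the three pairings of four indices. The last corrects the
all-equal case, which the pairings count three times although the fourth moment is only `2ν²`. -/
lemma integral_norm_sq_quadratic (hX : ∀ i, Measurable (X i)) (hind : iIndepFun X P)
    (hb : ∀ i, ∀ᵐ ω ∂P, |X i ω| ≤ b)
    (h1 : ∀ i, ∫ ω, X i ω ∂P = 0) (h2 : ∀ i, ∫ ω, X i ω ^ 2 ∂P = ν)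
    (h3 : ∀ i, ∫ ω, X i ω ^ 3 ∂P = 0) (h4 : ∀ i, ∫ ω, X i ω ^ 4 ∂P = 2 * ν ^ 2)
    (w : ι → ι → ℂ) :
    ∫ ω, ‖∑ i, ∑ j, ((X i ω * X j ω : ℝ) : ℂ) * w i j‖ ^ 2 ∂P =
      ν ^ 2 * (‖∑ i, w i i‖ ^ 2 + ∑ i, ∑ j, ‖w i j‖ ^ 2 + ∑ i, ∑ j, (w i j * star (w j i)).re -
        ∑ i, ‖w i i‖ ^ 2) := by
  have hint : ∀ i j k l, Integrable (fun ω => X i ω * X j ω * (X k ω * X l ω) *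
      (w i j * star (w k l)).re) P := fun i j k l =>
    integrable_continuous_comp_of_bounded hX hb
      (g := fun y => y i * y j * (y k * y l) * (w i j * star (w k l)).re) (by fun_prop)
  simp only [norm_sum_sum_sq (fun i j => X i _ * X j _)]
  have hstep : ∫ ω, ∑ i, ∑ j, ∑ k, ∑ l, X i ω * X j ω * (X k ω * X l ω) *
      (w i j * star (w k l)).re ∂P = ∑ i, ∑ j, ∑ k, ∑ l,
        (∫ ω, X i ω * X j ω * X k ω * X l ω ∂P) * (w i j * star (w k l)).re := by
    rw [integral_finsetSum _ fun i _ => integrable_finsetSum _ fun j _ =>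
      integrable_finsetSum _ fun k _ => integrable_finsetSum _ fun l _ => hint i j k l]
    refine Finset.sum_congr rfl fun i _ => ?_
    rw [integral_finsetSum _ fun j _ =>
      integrable_finsetSum _ fun k _ => integrable_finsetSum _ fun l _ => hint i j k l]
    refine Finset.sum_congr rfl fun j _ => ?_
    rw [integral_finsetSum _ fun k _ => integrable_finsetSum _ fun l _ => hint i j k l]
    refine Finset.sum_congr rfl fun k _ => ?_
    rw [integral_finsetSum _ fun l _ => hint i j k l]
    refine Finset.sum_congr rfl fun l _ => ?_
    rw [integral_mul_const]
    simp only [mul_assoc]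
  have hdiag : ∀ z : ℂ, (z * star z).re = ‖z‖ ^ 2 := fun z => by
    rw [Complex.star_def, Complex.mul_conj, Complex.ofReal_re, Complex.normSq_eq_norm_sq]
  have htr : ‖∑ i, w i i‖ ^ 2 = ∑ i, ∑ k, (w i i * star (w k k)).re := by
    rw [← hdiag, star_sum, Finset.sum_mul_sum]
    simp only [Complex.re_sum]
  rw [hstep]
  simp only [integral_mul_four hX hind h1 h2 h3 h4]
  simp only [mul_assoc, ← Finset.mul_sum]
  congr 1
  simp only [add_mul, sub_mul, Finset.sum_add_distrib, Finset.sum_sub_distrib, ite_mul, zero_mul,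
    one_mul, Finset.sum_ite_irrel, Finset.sum_const_zero, Finset.sum_ite_eq, Finset.mem_univ,
    if_true, htr, hdiag]

end Moments

/-! ### Sixth moments of linear forms via subgaussian bounds. -/

section SixthMoment

variable {Ω ι : Type*} [MeasurableSpace Ω] {P : Measure Ω} [IsProbabilityMeasure P]
  [Fintype ι] {X : ι → Ω → ℝ} {b : ℝ}

lemma pow_six_le_exp_add_exp_neg (y : ℝ) : y ^ 6 ≤ 720 * (Real.exp y + Real.exp (-y)) := by
  have h : ∀ z : ℝ, 0 ≤ z → z ^ 6 ≤ 720 * Real.exp z := fun z hz => by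
    have := Real.pow_div_factorial_le_exp z hz 6
    rw [div_le_iff₀ (by positivity)] at this
    simpa [Nat.factorial, mul_comm] using this
  rcases le_total 0 y with hy | hy
  · linarith [h y hy, Real.exp_pos (-y)]
  · have := h (-y) (by linarith)
    rw [Even.neg_pow (by decide)] at this
    linarith [Real.exp_pos y]

/-- Hoeffding's lemma: each summand is centred with values in `[-|a i| b, |a i| b]`, so its variance
proxy is `(a i)² b²`, and proxies add under independence. -/
lemma mgf_sum_const_mul_le (hX : ∀ i, Measurable (X i)) (hind : iIndepFun X P)
    (hb : ∀ i, ∀ᵐ ω ∂P, |X i ω| ≤ b) (h1 : ∀ i, ∫ ω, X i ω ∂P = 0) (a : ι → ℝ) (t : ℝ) :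
    mgf (fun ω => ∑ i, a i * X i ω) P t ≤ Real.exp (b ^ 2 * (∑ i, a i ^ 2) * t ^ 2 / 2) := by
  have hsub : ∀ i ∈ Finset.univ, HasSubgaussianMGF (fun ω => a i * X i ω)
      ((‖|a i| * b - -(|a i| * b)‖₊ / 2) ^ 2) P := fun i _ => by
    refine hasSubgaussianMGF_of_mem_Icc_of_integral_eq_zero
      ((hX i).const_mul (a i)).aemeasurable ?_ ?_
    · filter_upwards [hb i] with ω hω
      refine abs_le.mp ?_
      rw [abs_mul]
      gcongr
    · rw [integral_const_mul, h1, mul_zero]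
  have hind' : iIndepFun (fun i ω => a i * X i ω) P :=
    hind.comp (fun i y => a i * y) fun i => measurable_const_mul (a i)
  refine ((HasSubgaussianMGF.sum_of_iIndepFun hind' hsub).mgf_le t).trans (le_of_eq ?_)
  congr 3
  rw [NNReal.coe_sum, Finset.mul_sum]
  refine Finset.sum_congr rfl fun i _ => ?_
  push_cast
  rw [sub_neg_eq_add, ← two_mul, norm_mul, Real.norm_ofNat, mul_div_cancel_left₀ _ two_ne_zero,
    Real.norm_eq_abs, sq_abs, mul_pow, sq_abs, mul_comm]

lemma integral_sum_pow_six_le (hX : ∀ i, Measurable (X i)) (hind : iIndepFun X P)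
    (hb : ∀ i, ∀ᵐ ω ∂P, |X i ω| ≤ b) (hb0 : 0 < b) (h1 : ∀ i, ∫ ω, X i ω ∂P = 0) {a : ι → ℝ}
    {A : ℝ} (hA : 0 < A) (ha : ∑ i, a i ^ 2 ≤ A) :
    ∫ ω, (∑ i, a i * X i ω) ^ 6 ∂P ≤ 2880 * (b ^ 6 * A ^ 3) := by
  -- At this scale the moment generating function at `±t` is at most `exp(1/2) ≤ 2`, hence the
  -- constant `2880 = 720 · (2 + 2)`.
  set t := (b * √A)⁻¹ with htd
  have hsA : √A ^ 2 = A := Real.sq_sqrt hA.le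
  have hsA0 : 0 < √A := Real.sqrt_pos.mpr hA
  have ht6 : t ^ 6 * (b ^ 6 * A ^ 3) = 1 := by
    rw [htd, ← hsA]
    field_simp
    simp
  have ht0 : 0 < t := by positivity
  have hmgf : ∀ r : ℝ, r ^ 2 = t ^ 2 → mgf (fun ω => ∑ i, a i * X i ω) P r ≤ 2 := fun r hr => by
    refine (mgf_sum_const_mul_le hX hind hb h1 a r).trans ?_
    have h2 : b ^ 2 * (∑ i, a i ^ 2) * r ^ 2 / 2 ≤ 1 / 2 := by
      have h3 : b ^ 2 * A * t ^ 2 = 1 := by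
        rw [htd, ← hsA]
        field_simp
        simp
      rw [hr]
      have h4 : b ^ 2 * (∑ i, a i ^ 2) * t ^ 2 ≤ b ^ 2 * A * t ^ 2 := by gcongr
      linarith
    refine (Real.exp_le_exp.mpr h2).trans ?_
    have h5 : Real.exp (1 / 2) ^ 2 = Real.exp 1 := by
      rw [← Real.exp_nat_mul]
      norm_num
    nlinarith [Real.exp_one_lt_d9, Real.exp_pos (1 / 2)]
  have hint : ∀ r : ℝ, Integrable (fun ω => Real.exp (r * ∑ i, a i * X i ω)) P := fun r =>
    integrable_continuous_comp_of_bounded hX hb (g := fun y => Real.exp (r * ∑ i, a i * y i))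
      (by fun_prop)
  have hint6 : Integrable (fun ω => (t * ∑ i, a i * X i ω) ^ 6) P :=
    integrable_continuous_comp_of_bounded hX hb (g := fun y => (t * ∑ i, a i * y i) ^ 6)
      (by fun_prop)
  have hkey : t ^ 6 * ∫ ω, (∑ i, a i * X i ω) ^ 6 ∂P ≤ 2880 := by
    rw [← integral_const_mul]
    simp only [← mul_pow]
    calc ∫ ω, (t * ∑ i, a i * X i ω) ^ 6 ∂P
        ≤ ∫ ω, 720 * (Real.exp (t * ∑ i, a i * X i ω) +
            Real.exp (-t * ∑ i, a i * X i ω)) ∂P := by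
          refine integral_mono hint6 (((hint t).add (hint (-t))).const_mul 720) fun ω => ?_
          simp only [neg_mul]
          exact pow_six_le_exp_add_exp_neg _
      _ = 720 * (mgf (fun ω => ∑ i, a i * X i ω) P t +
            mgf (fun ω => ∑ i, a i * X i ω) P (-t)) := by
          rw [integral_const_mul, integral_add (hint t) (hint (-t))]
          rfl
      _ ≤ 2880 := by linarith [hmgf t rfl, hmgf (-t) (neg_sq t)]
  have hpos : 0 < b ^ 6 * A ^ 3 := by positivity
  calc ∫ ω, (∑ i, a i * X i ω) ^ 6 ∂P
      = (t ^ 6 * ∫ ω, (∑ i, a i * X i ω) ^ 6 ∂P) * (b ^ 6 * A ^ 3) := by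
        rw [mul_right_comm, ht6, one_mul]
    _ ≤ 2880 * (b ^ 6 * A ^ 3) := by gcongr

lemma integral_norm_sum_pow_six_le (hX : ∀ i, Measurable (X i)) (hind : iIndepFun X P)
    (hb : ∀ i, ∀ᵐ ω ∂P, |X i ω| ≤ b) (hb0 : 0 < b) (h1 : ∀ i, ∫ ω, X i ω ∂P = 0) {a : ι → ℂ}
    {A : ℝ} (hA : 0 < A) (ha : ∑ i, ‖a i‖ ^ 2 ≤ A) :
    ∫ ω, ‖∑ i, (X i ω : ℂ) * a i‖ ^ 6 ∂P ≤ 23040 * (b ^ 6 * A ^ 3) := by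
  have hsq : ∀ z : ℂ, ‖z‖ ^ 2 = z.re ^ 2 + z.im ^ 2 := fun z => by
    rw [← Complex.normSq_eq_norm_sq, Complex.normSq_apply]
    ring
  have hre : ∑ i, (a i).re ^ 2 ≤ A :=
    (Finset.sum_le_sum fun i _ => by rw [hsq]; linarith [sq_nonneg (a i).im]).trans ha
  have him : ∑ i, (a i).im ^ 2 ≤ A :=
    (Finset.sum_le_sum fun i _ => by rw [hsq]; linarith [sq_nonneg (a i).re]).trans ha
  have hpt : ∀ ω, ‖∑ i, (X i ω : ℂ) * a i‖ ^ 6 ≤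
      4 * ((∑ i, (a i).re * X i ω) ^ 6 + (∑ i, (a i).im * X i ω) ^ 6) := fun ω => by
    set z := ∑ i, (X i ω : ℂ) * a i with hz
    have h1 : z.re = ∑ i, (a i).re * X i ω := by
      simp [hz, Complex.re_sum, mul_comm]
    have h2 : z.im = ∑ i, (a i).im * X i ω := by
      simp [hz, Complex.im_sum, mul_comm]
    rw [← h1, ← h2]
    calc ‖z‖ ^ 6 = (‖z‖ ^ 2) ^ 3 := by ring
      _ = (z.re ^ 2 + z.im ^ 2) ^ 3 := by rw [hsq]
      -- Uses `4(p³ + q³) - (p + q)³ = 3(p + q)(p - q)²`. Real and imaginary parts together give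
      -- `23040 = 4 · 2 · 2880`.
      _ ≤ 4 * ((z.re ^ 2) ^ 3 + (z.im ^ 2) ^ 3) := by
        have := mul_nonneg (add_nonneg (sq_nonneg z.re) (sq_nonneg z.im))
          (sq_nonneg (z.re ^ 2 - z.im ^ 2))
        linarith
      _ = _ := by ring
  have hi : ∀ c : ι → ℝ, Integrable (fun ω => (∑ i, c i * X i ω) ^ 6) P := fun c =>
    integrable_continuous_comp_of_bounded hX hb (g := fun y => (∑ i, c i * y i) ^ 6)
      (by fun_prop)
  calc ∫ ω, ‖∑ i, (X i ω : ℂ) * a i‖ ^ 6 ∂P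
      ≤ ∫ ω, 4 * ((∑ i, (a i).re * X i ω) ^ 6 + (∑ i, (a i).im * X i ω) ^ 6) ∂P :=
        integral_mono (integrable_continuous_comp_of_bounded hX hb
          (g := fun y => ‖∑ i, (y i : ℂ) * a i‖ ^ 6) (by fun_prop))
          (((hi _).add (hi _)).const_mul 4) hpt
    _ = 4 * (∫ ω, (∑ i, (a i).re * X i ω) ^ 6 ∂P + ∫ ω, (∑ i, (a i).im * X i ω) ^ 6 ∂P) := by
        rw [integral_const_mul, integral_add (hi _) (hi _)]
    _ ≤ 23040 * (b ^ 6 * A ^ 3) := by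
        linarith [integral_sum_pow_six_le hX hind hb hb0 h1 hA hre,
          integral_sum_pow_six_le hX hind hb hb0 h1 hA him]

end SixthMoment

/-! ### Independence of the masks from independence of their entries. -/

section Curry

variable {Ω ι κ E : Type*} [MeasurableSpace Ω] {P : Measure Ω} [MeasurableSpace E]

/-- The rows of an array of independent random variables are independent. -/
lemma iIndepFun_curry {X : ι → κ → Ω → E} (hX : ∀ i j, Measurable (X i j))
    (hind : iIndepFun (fun (p : ι × κ) ω => X p.1 p.2 ω) P) :
    iIndepFun (fun i ω j => X i j ω) P := by
  have hP := hind.isProbabilityMeasure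
  have h1 : iIndepFun (fun (p : (_ : ι) × κ) ω => X p.1 p.2 ω) P :=
    hind.precomp (Equiv.sigmaEquivProd ι κ).injective
  have hp : ∀ i j, IsProbabilityMeasure (P.map (X i j)) :=
    fun i j => Measure.isProbabilityMeasure_map (hX i j).aemeasurable
  have hcomp : (fun ω i j => X i j ω) =
      (MeasurableEquiv.piCurry fun (_ : ι) (_ : κ) => E) ∘
        fun ω (p : (_ : ι) × κ) => X p.1 p.2 ω := by
    ext
    simp [Sigma.curry]
  rw [iIndepFun_iff_map_fun_eq_infinitePi_map (by fun_prop), hcomp,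
    ← Measure.map_map (by fun_prop) (by fun_prop),
    (iIndepFun_iff_map_fun_eq_infinitePi_map (by fun_prop)).1 h1,
    Measure.infinitePi_map_piCurry (fun i j => P.map (X i j))]
  congr with i
  have h2 : iIndepFun (X i) P := hind.precomp (g := fun j => (i, j)) fun _ _ h => by simpa using h
  rw [(iIndepFun_iff_map_fun_eq_infinitePi_map (by fun_prop)).1 h2]

end Curry

/-! ### Geometry of the tangent space. -/

section TangentSpace

variable {d : ℕ}

lemma frobenius_norm_sq (Z : Matrix (Fin d) (Fin d) ℂ) : ‖Z‖ ^ 2 = ∑ i, ∑ j, ‖Z i j‖ ^ 2 := by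
  rw [frobenius_norm_def, ← Real.sqrt_eq_rpow, Real.sq_sqrt]
  · norm_cast
  · positivity

lemma norm_sq_tangent (x z : Fin d → ℂ) :
    ‖vecMulVec x (star z) + vecMulVec z (star x)‖ ^ 2 =
      2 * (∑ i, ‖x i‖ ^ 2) * (∑ i, ‖z i‖ ^ 2) + 2 * ((star x ⬝ᵥ z) ^ 2).re := by
  have hn : ∀ v : ℂ, ((‖v‖ ^ 2 : ℝ) : ℂ) = v * star v := fun v => by
    rw [← Complex.normSq_eq_norm_sq, Complex.star_def, Complex.mul_conj]
  have key : ((‖vecMulVec x (star z) + vecMulVec z (star x)‖ ^ 2 : ℝ) : ℂ) =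
      2 * (∑ i, x i * star (x i)) * (∑ i, z i * star (z i)) +
        ((star x ⬝ᵥ z) ^ 2 + star ((star x ⬝ᵥ z) ^ 2)) := by
    rw [frobenius_norm_sq]
    push_cast
    have h1 : ∀ i j, (((‖(vecMulVec x (star z) + vecMulVec z (star x)) i j‖ : ℝ) : ℂ) ^ 2) =
        (x i * star (x i)) * (z j * star (z j)) + (z i * star (z i)) * (x j * star (x j)) +
        ((star (x i) * z i) * (star (x j) * z j) +
          star (star (x i) * z i) * star (star (x j) * z j)) := fun i j => by
      rw [← Complex.ofReal_pow, hn]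
      simp only [Matrix.add_apply, vecMulVec_apply, Pi.star_apply, star_add, star_mul', star_star]
      ring
    simp only [h1, Finset.sum_add_distrib, ← Finset.mul_sum, ← Finset.sum_mul]
    have h2 : star x ⬝ᵥ z = ∑ i, star (x i) * z i := rfl
    rw [star_pow, h2, star_sum]
    ring
  have h3 := congrArg Complex.re key
  simp only [← hn, ← Complex.ofReal_sum] at h3
  rw [Complex.ofReal_re] at h3
  rw [h3]
  have h4 : (2 * (((∑ i, ‖x i‖ ^ 2 : ℝ)) : ℂ) * ((∑ i, ‖z i‖ ^ 2 : ℝ) : ℂ)).re =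
      2 * (∑ i, ‖x i‖ ^ 2) * (∑ i, ‖z i‖ ^ 2) := by
    norm_cast
  rw [Complex.add_re, h4, Complex.add_re, Complex.star_def, Complex.conj_re]
  ring

/-- Imaginary multiples of `x` can be subtracted from `z` without changing `Z`. Choosing `⟨x, z⟩`
real makes the cross term in `‖Z‖² = 2‖z‖² + 2 Re ⟨x, z⟩²` nonnegative. -/
lemma exists_tangent_representative {x : EuclideanSpace ℂ (Fin d)} (hx : ‖x‖ = 1)
    {Z : Matrix (Fin d) (Fin d) ℂ} (hZ : Z ∈ tangentSpace x) :
    ∃ z : Fin d → ℂ, Z = vecMulVec x.ofLp (star z) + vecMulVec z (star x.ofLp) ∧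
      2 * ∑ i, ‖z i‖ ^ 2 ≤ ‖Z‖ ^ 2 := by
  obtain ⟨z, rfl⟩ := hZ
  have hx2 : ∑ i, ‖x.ofLp i‖ ^ 2 = 1 := by
    rw [← EuclideanSpace.norm_sq_eq, hx, one_pow]
  have hxx : star x.ofLp ⬝ᵥ x.ofLp = 1 := by
    have h : star x.ofLp ⬝ᵥ x.ofLp = ((∑ i, ‖x.ofLp i‖ ^ 2 : ℝ) : ℂ) := by
      push_cast
      refine Finset.sum_congr rfl fun i _ => ?_
      rw [Pi.star_apply, Complex.star_def, Complex.conj_mul']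
    rw [h, hx2, Complex.ofReal_one]
  set s : ℝ := (star x.ofLp ⬝ᵥ z).im with hs
  refine ⟨z - (s * Complex.I) • x.ofLp, ?_, ?_⟩
  · ext i j
    simp only [Matrix.add_apply, vecMulVec_apply, Pi.star_apply, Pi.sub_apply, Pi.smul_apply,
      smul_eq_mul, star_sub, star_mul', Complex.star_def, Complex.conj_I, Complex.conj_ofReal]
    ring
  · set w := z - (s * Complex.I) • x.ofLp with hw
    have h1 : vecMulVec x.ofLp (star z) + vecMulVec z (star x.ofLp) =
        vecMulVec x.ofLp (star w) + vecMulVec w (star x.ofLp) := by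
      ext i j
      simp only [hw, Matrix.add_apply, vecMulVec_apply, Pi.star_apply, Pi.sub_apply,
        Pi.smul_apply, smul_eq_mul, star_sub, star_mul', Complex.star_def, Complex.conj_I,
        Complex.conj_ofReal]
      ring
    have h2 : (star x.ofLp ⬝ᵥ w).im = 0 := by
      rw [hw, dotProduct_sub, dotProduct_smul, hxx]
      simp [hs]
    rw [h1, norm_sq_tangent, hx2]
    have h3 : 0 ≤ ((star x.ofLp ⬝ᵥ w) ^ 2).re := by
      rw [sq, Complex.mul_re, h2]
      nlinarith [sq_nonneg (star x.ofLp ⬝ᵥ w).re]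
    linarith

/-- The parametrization `z ↦ x z^* + z x^*` of the tangent space, with the matrices read as
vectors of a real inner product space. -/
noncomputable def tangentMap (x : Fin d → ℂ) :
    (Fin d → ℂ) →ₗ[ℝ] EuclideanSpace ℂ (Fin d × Fin d) where
  toFun z := WithLp.toLp 2 fun p => x p.1 * star (z p.2) + z p.1 * star (x p.2)
  map_add' z w := by
    ext p
    simp
    ring
  map_smul' r z := by
    ext p
    simp
    ring

/-- The vector `I • x` lies in the kernel. The dimension thus saved matters: `2d - 1 ≤ d²` always
holds, while `2d ≤ d²` fails for `d = 1`. -/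
lemma finrank_range_tangentMap_add_one_le {x : Fin d → ℂ} (hx : x ≠ 0) :
    Module.finrank ℝ (LinearMap.range (tangentMap x)) + 1 ≤ 2 * d := by
  have h1 := LinearMap.finrank_range_add_finrank_ker (tangentMap x)
  have h2 : Module.finrank ℝ (Fin d → ℂ) = 2 * d := by
    rw [Module.finrank_pi_fintype]
    simp [Complex.finrank_real_complex, mul_comm]
  have h3 : Complex.I • x ∈ LinearMap.ker (tangentMap x) := by
    rw [LinearMap.mem_ker]
    ext p
    simp [tangentMap]
    ring
  have h4 : 0 < Module.finrank ℝ (LinearMap.ker (tangentMap x)) := by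
    rw [Module.finrank_pos_iff_exists_ne_zero]
    refine ⟨⟨_, h3⟩, fun h => hx ?_⟩
    have := congrArg Subtype.val h
    simpa [smul_eq_zero] using this
  omega

/-- The coefficients are real because `T` is only a real subspace; the second property is
orthonormality in the form used later. -/
lemma exists_tangent_basis {x : EuclideanSpace ℂ (Fin d)} (hx : ‖x‖ = 1) :
    ∃ n : ℕ, n + 1 ≤ 2 * d ∧ ∃ B : Fin n → Matrix (Fin d) (Fin d) ℂ,
      (∀ c : Fin n → ℝ, ∑ p, (c p : ℂ) • B p ∈ tangentSpace x) ∧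
      (∀ c : Fin n → ℝ, ‖∑ p, (c p : ℂ) • B p‖ ^ 2 = c ⬝ᵥ c) ∧
      ∀ Z ∈ tangentSpace x, ∃ c : Fin n → ℝ, Z = ∑ p, (c p : ℂ) • B p := by
  have hx0 : x.ofLp ≠ 0 := fun h => by
    have : x = 0 := by
      ext i
      exact congrFun h i
    rw [this, norm_zero] at hx
    exact zero_ne_one hx
  let V := LinearMap.range (tangentMap x.ofLp)
  let e := stdOrthonormalBasis ℝ V
  let B : Fin (Module.finrank ℝ V) → Matrix (Fin d) (Fin d) ℂ :=
    fun p => Matrix.of fun i j => (e p : EuclideanSpace ℂ (Fin d × Fin d)) (i, j)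
  have hB : ∀ (c : Fin (Module.finrank ℝ V) → ℝ) i j, (∑ p, (c p : ℂ) • B p) i j =
      ((∑ p, c p • e p : V) : EuclideanSpace ℂ (Fin d × Fin d)) (i, j) := fun c i j => by
    simp [B, Matrix.sum_apply]
  refine ⟨Module.finrank ℝ V, finrank_range_tangentMap_add_one_le hx0, B, fun c => ?_, fun c => ?_, fun Z hZ => ?_⟩
  · obtain ⟨z, hz⟩ := (∑ p, c p • e p : V).2
    refine ⟨z, ?_⟩
    ext i j
    rw [hB, ← hz]
    simp [tangentMap, vecMulVec_apply]
  · have h1 : ‖∑ p, (c p : ℂ) • B p‖ ^ 2 = ‖(∑ p, c p • e p : V)‖ ^ 2 := by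
      rw [frobenius_norm_sq, Submodule.coe_norm, EuclideanSpace.norm_sq_eq,
        Fintype.sum_prod_type]
      exact Finset.sum_congr rfl fun i _ => Finset.sum_congr rfl fun j _ => by rw [hB]
    rw [h1, ← real_inner_self_eq_norm_sq, e.orthonormal.inner_sum]
    simp [dotProduct]
  · obtain ⟨z, rfl⟩ := hZ
    let v : V := ⟨tangentMap x.ofLp z, LinearMap.mem_range_self _ z⟩
    refine ⟨fun p => e.repr v p, ?_⟩
    ext i j
    rw [hB, e.sum_repr v]
    simp [v, tangentMap, vecMulVec_apply]

end TangentSpace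

/-! ### The energy of one mask as a positive semidefinite matrix. -/

section FormMatrix

variable {d n : ℕ}

/-- The real part of `tr (F_k Z)`. -/
noncomputable def traceRe (a : Fin d → ℝ) (k : Fin d) (Z : Matrix (Fin d) (Fin d) ℂ) : ℝ :=
  (measurementMatrix a k * Z).trace.re

lemma traceRe_eq_sum (a : Fin d → ℝ) (k : Fin d) (Z : Matrix (Fin d) (Fin d) ℂ) :
    traceRe a k Z =
      ∑ i, ∑ j, a i * a j * (fourierVec k j * star (fourierVec k i) * Z i j).re := by
  rw [traceRe, trace_measurementMatrix_mul]
  simp only [Complex.re_sum, Complex.re_ofReal_mul]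

lemma continuous_traceRe (k : Fin d) (Z : Matrix (Fin d) (Fin d) ℂ) :
    Continuous fun a => traceRe a k Z := by
  simp only [traceRe_eq_sum]
  fun_prop

lemma continuous_amplitude (k : Fin d) (v : Fin d → ℂ) :
    Continuous fun a => amplitude a k v := by
  unfold amplitude
  fun_prop

lemma traceRe_sum_smul (a : Fin d → ℝ) (k : Fin d) (B : Fin n → Matrix (Fin d) (Fin d) ℂ)
    (c : Fin n → ℝ) :
    traceRe a k (∑ p, (c p : ℂ) • B p) = ∑ p, c p * traceRe a k (B p) := by
  simp only [traceRe, Matrix.mul_sum, trace_sum, Matrix.mul_smul, trace_smul, Complex.re_sum,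
    smul_eq_mul, Complex.re_ofReal_mul]

lemma traceRe_tangent (a : Fin d → ℝ) (k : Fin d) (x z : Fin d → ℂ) :
    traceRe a k (vecMulVec x (star z) + vecMulVec z (star x)) =
      2 * (amplitude a k x * star (amplitude a k z)).re := by
  rw [traceRe, trace_measurementMatrix_mul_tangent, Complex.ofReal_re]

lemma abs_traceRe_tangent_le (a : Fin d → ℝ) (k : Fin d) (x z : Fin d → ℂ) :
    |traceRe a k (vecMulVec x (star z) + vecMulVec z (star x))| ≤
      2 * (‖amplitude a k x‖ * ‖amplitude a k z‖) := by
  rw [traceRe_tangent, abs_mul, abs_two, ← norm_star (amplitude a k z), ← norm_mul]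
  gcongr
  exact Complex.abs_re_le_norm _

lemma norm_trace_sq_of_mem_tangentSpace {x : EuclideanSpace ℂ (Fin d)}
    {Z : Matrix (Fin d) (Fin d) ℂ} (hZ : Z ∈ tangentSpace x) (a : Fin d → ℝ) (k : Fin d) :
    ‖(measurementMatrix a k * Z).trace‖ ^ 2 = traceRe a k Z ^ 2 := by
  obtain ⟨z, rfl⟩ := hZ
  rw [traceRe, trace_measurementMatrix_mul_tangent, Complex.ofReal_re, Complex.norm_real,
    Real.norm_eq_abs, sq_abs]

lemma norm_measurementOp_sq {L : ℕ} {x : EuclideanSpace ℂ (Fin d)}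
    {Z : Matrix (Fin d) (Fin d) ℂ} (hZ : Z ∈ tangentSpace x) (a : Fin L → Fin d → ℝ) :
    ‖measurementOp a Z‖ ^ 2 = ∑ l, ∑ k, traceRe (a l) k Z ^ 2 := by
  rw [EuclideanSpace.norm_sq_eq, Fintype.sum_prod_type_right]
  refine Finset.sum_congr rfl fun l _ => Finset.sum_congr rfl fun k _ => ?_
  exact norm_trace_sq_of_mem_tangentSpace hZ (a l) k

/-- The matrix of the quadratic form `Z ↦ κ ∑ k, tr (F_k Z) ^ 2` with respect to the family `B`. -/
noncomputable def formMatrix (κ : ℝ) (B : Fin n → Matrix (Fin d) (Fin d) ℂ) (a : Fin d → ℝ) :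
    Matrix (Fin n) (Fin n) ℝ :=
  Matrix.of fun p q => κ * ∑ k, traceRe a k (B p) * traceRe a k (B q)

lemma dotProduct_formMatrix_mulVec (κ : ℝ) (B : Fin n → Matrix (Fin d) (Fin d) ℂ)
    (a : Fin d → ℝ) (y c : Fin n → ℝ) :
    y ⬝ᵥ (formMatrix κ B a *ᵥ c) = κ * ∑ k, traceRe a k (∑ p, (y p : ℂ) • B p) *
      traceRe a k (∑ p, (c p : ℂ) • B p) := by
  have h : ∀ p, y p * (formMatrix κ B a *ᵥ c) p =
      ∑ k, ∑ q, κ * (y p * traceRe a k (B p) * (c q * traceRe a k (B q))) := fun p => by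
    rw [Finset.sum_comm]
    simp only [mulVec, dotProduct, formMatrix, of_apply, Finset.mul_sum, Finset.sum_mul]
    refine Finset.sum_congr rfl fun q _ => Finset.sum_congr rfl fun k _ => ?_
    ring
  simp only [traceRe_sum_smul, Finset.sum_mul_sum, dotProduct, h]
  rw [Finset.sum_comm, Finset.mul_sum]
  simp only [Finset.mul_sum]

lemma posSemidef_formMatrix {κ : ℝ} (hκ : 0 ≤ κ) (B : Fin n → Matrix (Fin d) (Fin d) ℂ)
    (a : Fin d → ℝ) : (formMatrix κ B a).PosSemidef := by
  refine PosSemidef.of_dotProduct_mulVec_nonneg ?_ fun c => ?_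
  · ext p q
    simp [formMatrix, mul_comm]
  · rw [star_trivial, dotProduct_formMatrix_mulVec]
    exact mul_nonneg hκ (Finset.sum_nonneg fun k _ => mul_self_nonneg _)

lemma continuous_formMatrix_apply (κ : ℝ) (B : Fin n → Matrix (Fin d) (Fin d) ℂ) (p q : Fin n) :
    Continuous fun a => formMatrix κ B a p q :=
  continuous_const.mul (continuous_finsetSum _ fun k _ =>
    (continuous_traceRe k (B p)).mul (continuous_traceRe k (B q)))

/-- With `y = M c`, the square `y ⬝ᵥ y` is the bilinear form of `M` at `(y, c)`. Cauchy–Schwarz puts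
a single amplitude of the representative `w` of `y` in one factor, where Parseval bounds it by `d b²
(y ⬝ᵥ y)/2`; one factor `y ⬝ᵥ y` then cancels. The fourth powers of amplitudes of the arbitrary
vector `w` never appear. -/
lemma dotProduct_self_formMatrix_mulVec_le {κ : ℝ} {x : EuclideanSpace ℂ (Fin d)} (hx : ‖x‖ = 1)
    {B : Fin n → Matrix (Fin d) (Fin d) ℂ}
    (hBT : ∀ c : Fin n → ℝ, ∑ p, (c p : ℂ) • B p ∈ tangentSpace x)
    (hBn : ∀ c : Fin n → ℝ, ‖∑ p, (c p : ℂ) • B p‖ ^ 2 = c ⬝ᵥ c)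
    {a : Fin d → ℝ} {b : ℝ} (ha : ∀ i, |a i| ≤ b) {c : Fin n → ℝ} {z : Fin d → ℂ}
    (hz : ∑ p, (c p : ℂ) • B p = vecMulVec x.ofLp (star z) + vecMulVec z (star x.ofLp)) :
    (formMatrix κ B a *ᵥ c) ⬝ᵥ (formMatrix κ B a *ᵥ c) ≤
      8 * κ ^ 2 * d * b ^ 2 * ∑ k, ‖amplitude a k x.ofLp‖ ^ 4 * ‖amplitude a k z‖ ^ 2 := by
  set y := formMatrix κ B a *ᵥ c with hy
  set S := ∑ k, ‖amplitude a k x.ofLp‖ ^ 4 * ‖amplitude a k z‖ ^ 2 with hS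
  have hS0 : 0 ≤ S := Finset.sum_nonneg fun k _ => by positivity
  have hyy : y ⬝ᵥ y = κ * ∑ k, traceRe a k (∑ p, (y p : ℂ) • B p) *
      traceRe a k (∑ p, (c p : ℂ) • B p) := by
    conv_lhs => rw [hy]
    rw [← dotProduct_formMatrix_mulVec, hy]
  obtain ⟨w, hw, hwn⟩ := exists_tangent_representative hx (hBT y)
  rw [hBn] at hwn
  have hyy0 : 0 ≤ y ⬝ᵥ y := Finset.sum_nonneg fun i _ => mul_self_nonneg (y i)
  have habs : |∑ k, traceRe a k (∑ p, (y p : ℂ) • B p) * traceRe a k (∑ p, (c p : ℂ) • B p)| ≤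
      ∑ k, (2 * ‖amplitude a k w‖) * (2 * (‖amplitude a k x.ofLp‖ ^ 2 * ‖amplitude a k z‖)) := by
    refine (Finset.abs_sum_le_sum_abs _ _).trans (Finset.sum_le_sum fun k _ => ?_)
    rw [hw, hz, abs_mul]
    refine (mul_le_mul (abs_traceRe_tangent_le a k _ _) (abs_traceRe_tangent_le a k _ _)
      (abs_nonneg _) (by positivity)).trans (le_of_eq ?_)
    ring
  have hsq : (y ⬝ᵥ y) ^ 2 ≤ (y ⬝ᵥ y) * (8 * κ ^ 2 * d * b ^ 2 * S) := by
    calc (y ⬝ᵥ y) ^ 2 = κ ^ 2 * |∑ k, traceRe a k (∑ p, (y p : ℂ) • B p) *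
          traceRe a k (∑ p, (c p : ℂ) • B p)| ^ 2 := by
          rw [hyy, mul_pow, sq_abs]
      _ ≤ κ ^ 2 * (∑ k, (2 * ‖amplitude a k w‖) *
          (2 * (‖amplitude a k x.ofLp‖ ^ 2 * ‖amplitude a k z‖))) ^ 2 := by gcongr
      _ ≤ κ ^ 2 * ((∑ k, (2 * ‖amplitude a k w‖) ^ 2) *
          ∑ k, (2 * (‖amplitude a k x.ofLp‖ ^ 2 * ‖amplitude a k z‖)) ^ 2) := by
          gcongr
          exact Finset.sum_mul_sq_le_sq_mul_sq _ _ _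
      _ = κ ^ 2 * ((4 * ∑ k, ‖amplitude a k w‖ ^ 2) * (4 * S)) := by
          simp only [mul_pow, ← Finset.mul_sum, hS, ← pow_mul]
          norm_num
      _ ≤ κ ^ 2 * ((4 * (d * (b ^ 2 * ((y ⬝ᵥ y) / 2)))) * (4 * S)) := by
          have := (sum_norm_sq_amplitude_le ha w).trans (mul_le_mul_of_nonneg_left
            (mul_le_mul_of_nonneg_left (by linarith : ∑ j, ‖w j‖ ^ 2 ≤ (y ⬝ᵥ y) / 2)
              (sq_nonneg b)) (Nat.cast_nonneg d))
          gcongr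
      _ = (y ⬝ᵥ y) * (8 * κ ^ 2 * d * b ^ 2 * S) := by ring
  rcases hyy0.eq_or_lt with h0 | h0
  · rw [← h0]
    positivity
  · rw [sq] at hsq
    exact le_of_mul_le_mul_left hsq h0

end FormMatrix

/-! ### Expected energy and the mixed sixth moment. -/

section Expectation

variable {Ω : Type*} [MeasurableSpace Ω] {P : Measure Ω} [IsProbabilityMeasure P]
  {d : ℕ} {X : Fin d → Ω → ℝ} {b ν : ℝ}

/-- The expected energy of the measurements produced by one random mask. -/
lemma sum_integral_norm_trace_sq (hd : Odd d) (hX : ∀ i, Measurable (X i)) (hind : iIndepFun X P)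
    (hb : ∀ i, ∀ᵐ ω ∂P, |X i ω| ≤ b)
    (h1 : ∀ i, ∫ ω, X i ω ∂P = 0) (h2 : ∀ i, ∫ ω, X i ω ^ 2 ∂P = ν)
    (h3 : ∀ i, ∫ ω, X i ω ^ 3 ∂P = 0) (h4 : ∀ i, ∫ ω, X i ω ^ 4 ∂P = 2 * ν ^ 2)
    (Z : Matrix (Fin d) (Fin d) ℂ) :
    ∑ k, ∫ ω, ‖(measurementMatrix (fun i => X i ω) k * Z).trace‖ ^ 2 ∂P =
      ν ^ 2 * d * (‖Z.trace‖ ^ 2 + ‖Z‖ ^ 2) := by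
  have hone : ∀ k i : Fin d, fourierVec k i * star (fourierVec k i) = 1 := fun k i => by
    rw [Complex.star_def, Complex.mul_conj, Complex.normSq_eq_norm_sq, norm_fourierVec]
    norm_num
  -- The transposed pairing carries the squared phase, so for odd `d` only `i = j` survives; the
  -- result cancels the diagonal correction exactly.
  have hcross : ∑ k : Fin d, ∑ i, ∑ j, (fourierVec k j * star (fourierVec k i) * Z i j *
      star (fourierVec k i * star (fourierVec k j) * Z j i)).re = d * ∑ i, ‖Z i i‖ ^ 2 := by
    have h : ∀ k i j : Fin d, fourierVec k j * star (fourierVec k i) * Z i j *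
        star (fourierVec k i * star (fourierVec k j) * Z j i) =
        (fourierVec k j * star (fourierVec k i)) ^ 2 * (Z i j * star (Z j i)) := fun k i j => by
      simp only [star_mul', star_star]
      ring
    rw [Finset.sum_comm, Finset.mul_sum]
    refine Finset.sum_congr rfl fun i _ => ?_
    rw [Finset.sum_comm]
    simp only [h, ← Complex.re_sum, ← Finset.sum_mul,
      sum_fourierVec_mul_star_pow (Nat.coprime_two_left.mpr hd), ite_mul, zero_mul,
      Finset.sum_ite_eq', Finset.mem_univ, if_true]
    rw [Complex.star_def, Complex.mul_conj, Complex.normSq_eq_norm_sq, ← Complex.ofReal_natCast,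
      ← Complex.ofReal_mul, Complex.ofReal_re]
  have hnorm : ∀ k i j : Fin d, ‖fourierVec k j * star (fourierVec k i) * Z i j‖ = ‖Z i j‖ :=
    fun k i j => by
      rw [norm_mul, norm_mul, norm_star, norm_fourierVec, norm_fourierVec, one_mul, one_mul]
  simp only [trace_measurementMatrix_mul]
  simp only [integral_norm_sq_quadratic hX hind hb h1 h2 h3 h4, ← Finset.mul_sum,
    Finset.sum_sub_distrib, Finset.sum_add_distrib, hcross, hone, one_mul, hnorm,
    Finset.sum_const, Finset.card_univ, Fintype.card_fin, nsmul_eq_mul]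
  rw [frobenius_norm_sq, trace]
  simp only [diag_apply]
  ring

lemma integral_amplitude_pow_six_le (hX : ∀ i, Measurable (X i)) (hind : iIndepFun X P)
    (hb : ∀ i, ∀ᵐ ω ∂P, |X i ω| ≤ b) (hb0 : 0 < b) (h1 : ∀ i, ∫ ω, X i ω ∂P = 0)
    {A : ℝ} (hA : 0 < A) {v : Fin d → ℂ} (hv : ∑ i, ‖v i‖ ^ 2 ≤ A) (k : Fin d) :
    ∫ ω, ‖amplitude (fun i => X i ω) k v‖ ^ 6 ∂P ≤ 23040 * (b ^ 6 * A ^ 3) := by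
  have h : ∀ ω, amplitude (fun i => X i ω) k v =
      ∑ i, (X i ω : ℂ) * (star (fourierVec k i) * v i) := fun ω => by
    refine Finset.sum_congr rfl fun i _ => ?_
    ring
  simp only [h]
  refine integral_norm_sum_pow_six_le hX hind hb hb0 h1 hA (le_trans (le_of_eq ?_) hv)
  refine Finset.sum_congr rfl fun i _ => ?_
  rw [norm_mul, norm_star, norm_fourierVec, one_mul]

lemma integral_amplitude_pow_four_mul_sq_le (hX : ∀ i, Measurable (X i)) (hind : iIndepFun X P)
    (hb : ∀ i, ∀ᵐ ω ∂P, |X i ω| ≤ b) (hb0 : 0 < b) (h1 : ∀ i, ∫ ω, X i ω ∂P = 0)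
    {A : ℝ} (hA : 0 < A) {u v : Fin d → ℂ} (hu : ∑ i, ‖u i‖ ^ 2 ≤ 1)
    (hv : ∑ i, ‖v i‖ ^ 2 ≤ A) (k : Fin d) :
    ∫ ω, ‖amplitude (fun i => X i ω) k u‖ ^ 4 * ‖amplitude (fun i => X i ω) k v‖ ^ 2 ∂P ≤
      23040 * b ^ 6 * A := by
  have hcu := continuous_amplitude k u
  have hcv := continuous_amplitude k v
  -- Weighted AM–GM, via `2u³ - 3u²v + v³ = (u - v)²(2u + v)` with `u = p²` and `v = q²/A`. The
  -- weights make both terms linear in `A` after the sixth moment bounds, with total `2/3 + 1/3 =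
  -- 1`.
  have hpt : ∀ p q : ℝ, p ^ 4 * q ^ 2 ≤ 2 * A / 3 * p ^ 6 + (3 * A ^ 2)⁻¹ * q ^ 6 := fun p q => by
    have h0 : 0 ≤ (p ^ 2 - q ^ 2 / A) ^ 2 * (2 * p ^ 2 + q ^ 2 / A) := by positivity
    have h2 : 2 * A / 3 * p ^ 6 + (3 * A ^ 2)⁻¹ * q ^ 6 - p ^ 4 * q ^ 2 =
        A / 3 * ((p ^ 2 - q ^ 2 / A) ^ 2 * (2 * p ^ 2 + q ^ 2 / A)) := by
      field_simp
      ring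
    have h3 := mul_nonneg (by positivity : 0 ≤ A / 3) h0
    linarith
  have hiu : Integrable (fun ω => ‖amplitude (fun i => X i ω) k u‖ ^ 6) P :=
    integrable_continuous_comp_of_bounded hX hb (g := fun a => ‖amplitude a k u‖ ^ 6)
      (hcu.norm.pow 6)
  have hiv : Integrable (fun ω => ‖amplitude (fun i => X i ω) k v‖ ^ 6) P :=
    integrable_continuous_comp_of_bounded hX hb (g := fun a => ‖amplitude a k v‖ ^ 6)
      (hcv.norm.pow 6)
  have hEu := integral_amplitude_pow_six_le hX hind hb hb0 h1 one_pos hu k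
  have hEv := integral_amplitude_pow_six_le hX hind hb hb0 h1 hA hv k
  calc ∫ ω, ‖amplitude (fun i => X i ω) k u‖ ^ 4 * ‖amplitude (fun i => X i ω) k v‖ ^ 2 ∂P
      ≤ ∫ ω, (2 * A / 3 * ‖amplitude (fun i => X i ω) k u‖ ^ 6 +
          (3 * A ^ 2)⁻¹ * ‖amplitude (fun i => X i ω) k v‖ ^ 6) ∂P :=
        integral_mono (integrable_continuous_comp_of_bounded hX hb
          (g := fun a => ‖amplitude a k u‖ ^ 4 * ‖amplitude a k v‖ ^ 2)
          ((hcu.norm.pow 4).mul (hcv.norm.pow 2)))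
          ((hiu.const_mul _).add (hiv.const_mul _)) fun ω => hpt _ _
    _ = 2 * A / 3 * ∫ ω, ‖amplitude (fun i => X i ω) k u‖ ^ 6 ∂P +
          (3 * A ^ 2)⁻¹ * ∫ ω, ‖amplitude (fun i => X i ω) k v‖ ^ 6 ∂P := by
        rw [integral_add (hiu.const_mul _) (hiv.const_mul _), integral_const_mul,
          integral_const_mul]
    _ ≤ 2 * A / 3 * (23040 * (b ^ 6 * 1 ^ 3)) + (3 * A ^ 2)⁻¹ * (23040 * (b ^ 6 * A ^ 3)) := by
        gcongr
    _ = 23040 * b ^ 6 * A := by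
        field_simp
        ring

end Expectation

/-! ### Assembling the tail bound for the tangent space. -/

section Concentration

variable {Ω : Type*} [MeasurableSpace Ω] {P : Measure Ω} [IsProbabilityMeasure P]
  {d n : ℕ} {b ν : ℝ}

lemma dotProduct_self_le_integral_formMatrix {X : Fin d → Ω → ℝ} (hd : Odd d) (hν : 0 < ν)
    (hX : ∀ i, Measurable (X i)) (hind : iIndepFun X P)
    (hb : ∀ i, ∀ᵐ ω ∂P, |X i ω| ≤ b)
    (h1 : ∀ i, ∫ ω, X i ω ∂P = 0) (h2 : ∀ i, ∫ ω, X i ω ^ 2 ∂P = ν)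
    (h3 : ∀ i, ∫ ω, X i ω ^ 3 ∂P = 0) (h4 : ∀ i, ∫ ω, X i ω ^ 4 ∂P = 2 * ν ^ 2)
    {x : EuclideanSpace ℂ (Fin d)} {B : Fin n → Matrix (Fin d) (Fin d) ℂ}
    (hBT : ∀ c : Fin n → ℝ, ∑ p, (c p : ℂ) • B p ∈ tangentSpace x)
    (hBn : ∀ c : Fin n → ℝ, ‖∑ p, (c p : ℂ) • B p‖ ^ 2 = c ⬝ᵥ c) (c : Fin n → ℝ) :
    c ⬝ᵥ c ≤ ∫ ω, c ⬝ᵥ (formMatrix (ν ^ 2 * d)⁻¹ B (fun i => X i ω) *ᵥ c) ∂P := by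
  have hd0 : (0 : ℝ) < d := Nat.cast_pos.mpr hd.pos
  set Z := ∑ p, (c p : ℂ) • B p with hZ
  have hZT : Z ∈ tangentSpace x := hBT c
  have hE := sum_integral_norm_trace_sq hd hX hind hb h1 h2 h3 h4 Z
  simp only [dotProduct_formMatrix_mulVec, ← hZ, ← sq]
  simp only [norm_trace_sq_of_mem_tangentSpace hZT] at hE
  rw [integral_const_mul, integral_finsetSum _ fun k _ =>
    integrable_continuous_comp_of_bounded hX hb (g := fun a => traceRe a k Z ^ 2)
      ((continuous_traceRe k Z).pow 2), hE, hBn, inv_mul_cancel_left₀ (by positivity)]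
  linarith [sq_nonneg ‖Z.trace‖]

/-- The bound is free of `d`: one factor `d` from Parseval and one from the sum over `k` cancel
against `κ² = ν⁻⁴ d⁻²`. The constant is `184320 = 8 · 23040`. -/
lemma integral_formMatrix_mulVec_le {X : Fin d → Ω → ℝ} (hd : 0 < d) (hν : 0 < ν)
    (hX : ∀ i, Measurable (X i)) (hind : iIndepFun X P)
    (hb : ∀ i, ∀ᵐ ω ∂P, |X i ω| ≤ b) (hb0 : 0 < b) (h1 : ∀ i, ∫ ω, X i ω ∂P = 0)
    {x : EuclideanSpace ℂ (Fin d)} (hx : ‖x‖ = 1) {B : Fin n → Matrix (Fin d) (Fin d) ℂ}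
    (hBT : ∀ c : Fin n → ℝ, ∑ p, (c p : ℂ) • B p ∈ tangentSpace x)
    (hBn : ∀ c : Fin n → ℝ, ‖∑ p, (c p : ℂ) • B p‖ ^ 2 = c ⬝ᵥ c) (c : Fin n → ℝ) :
    ∫ ω, (formMatrix (ν ^ 2 * d)⁻¹ B (fun i => X i ω) *ᵥ c) ⬝ᵥ
      (formMatrix (ν ^ 2 * d)⁻¹ B (fun i => X i ω) *ᵥ c) ∂P ≤
      184320 * b ^ 8 / ν ^ 4 * (c ⬝ᵥ c) := by
  have hd0 : (0 : ℝ) < d := Nat.cast_pos.mpr hd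
  set κ := (ν ^ 2 * d : ℝ)⁻¹ with hκ
  have hcc : 0 ≤ c ⬝ᵥ c := Finset.sum_nonneg fun i _ => mul_self_nonneg (c i)
  rcases hcc.eq_or_lt with h0 | h0
  · have hc : c = 0 := dotProduct_self_eq_zero.mp h0.symm
    simp [hc]
  obtain ⟨z, hz, hzn⟩ := exists_tangent_representative hx (hBT c)
  rw [hBn] at hzn
  have hzA : ∑ i, ‖z i‖ ^ 2 ≤ c ⬝ᵥ c := by
    have : 0 ≤ ∑ i, ‖z i‖ ^ 2 := Finset.sum_nonneg fun i _ => by positivity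
    linarith
  have hx1 : ∑ i, ‖x.ofLp i‖ ^ 2 ≤ 1 := by
    rw [← EuclideanSpace.norm_sq_eq, hx, one_pow]
  have hi : ∀ k, Integrable (fun ω => ‖amplitude (fun i => X i ω) k x.ofLp‖ ^ 4 *
      ‖amplitude (fun i => X i ω) k z‖ ^ 2) P := fun k =>
    integrable_continuous_comp_of_bounded hX hb
      (g := fun a => ‖amplitude a k x.ofLp‖ ^ 4 * ‖amplitude a k z‖ ^ 2)
      (((continuous_amplitude k _).norm.pow 4).mul ((continuous_amplitude k _).norm.pow 2))
  calc ∫ ω, (formMatrix κ B (fun i => X i ω) *ᵥ c) ⬝ᵥ (formMatrix κ B (fun i => X i ω) *ᵥ c) ∂P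
      ≤ ∫ ω, 8 * κ ^ 2 * d * b ^ 2 * ∑ k, ‖amplitude (fun i => X i ω) k x.ofLp‖ ^ 4 *
          ‖amplitude (fun i => X i ω) k z‖ ^ 2 ∂P := by
        refine integral_mono_of_nonneg (Eventually.of_forall fun ω =>
          Finset.sum_nonneg fun i _ => mul_self_nonneg _)
          ((integrable_finsetSum _ fun k _ => hi k).const_mul _) ?_
        filter_upwards [ae_all_iff.mpr hb] with ω hω
        exact dotProduct_self_formMatrix_mulVec_le hx hBT hBn hω hz
    _ = 8 * κ ^ 2 * d * b ^ 2 * ∑ k, ∫ ω, ‖amplitude (fun i => X i ω) k x.ofLp‖ ^ 4 *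
          ‖amplitude (fun i => X i ω) k z‖ ^ 2 ∂P := by
        rw [integral_const_mul, integral_finsetSum _ fun k _ => hi k]
    _ ≤ 8 * κ ^ 2 * d * b ^ 2 * ∑ _k : Fin d, 23040 * b ^ 6 * (c ⬝ᵥ c) := by
        gcongr with k
        exact integral_amplitude_pow_four_mul_sq_le hX hind hb hb0 h1 h0 hx1 hzA k
    _ = 184320 * b ^ 8 / ν ^ 4 * (c ⬝ᵥ c) := by
        rw [Finset.sum_const, Finset.card_univ, Fintype.card_fin, nsmul_eq_mul, hκ]
        field_simp
        norm_num

theorem measure_not_robustlyInjective_le {L : ℕ} {ε : Fin L → Fin d → Ω → ℝ} (hd : Odd d)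
    (hL : 0 < L) (hν : 0 < ν) (hb0 : 0 < b) (hε : ∀ l i, Measurable (ε l i))
    (hind : iIndepFun (fun p : Fin L × Fin d => ε p.1 p.2) P)
    (hb : ∀ l i, ∀ᵐ ω ∂P, |ε l i ω| ≤ b)
    (h1 : ∀ l i, ∫ ω, ε l i ω ∂P = 0) (h2 : ∀ l i, ∫ ω, ε l i ω ^ 2 ∂P = ν)
    (h3 : ∀ l i, ∫ ω, ε l i ω ^ 3 ∂P = 0) (h4 : ∀ l i, ∫ ω, ε l i ω ^ 4 ∂P = 2 * ν ^ 2)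
    {x : EuclideanSpace ℂ (Fin d)} (hx : ‖x‖ = 1) {δ : ℝ} (hδ : 0 ≤ δ) :
    P.real {ω | ¬ RobustlyInjective ν (1 - δ) x (fun l i => ε l i ω)} ≤
      (d : ℝ) ^ 2 * Real.exp (-(ν ^ 4 * δ ^ 2 * L / (368640 * b ^ 8))) := by
  have hd0 : (0 : ℝ) < d := Nat.cast_pos.mpr hd.pos
  have hL0 : (0 : ℝ) < L := Nat.cast_pos.mpr hL
  obtain ⟨n, hn, B, hBT, hBn, hBs⟩ := exists_tangent_basis hx
  set κ := (ν ^ 2 * d : ℝ)⁻¹ with hκ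
  have hindl : ∀ l, iIndepFun (ε l) P := fun l =>
    hind.precomp (g := fun i => (l, i)) fun _ _ h => by simpa using h
  have hcont : ∀ c : Fin n → ℝ, Continuous fun a => formMatrix κ B a *ᵥ c := fun c =>
    (continuous_matrix fun p q => continuous_formMatrix_apply κ B p q).matrix_mulVec
      continuous_const
  have key := measure_exists_dotProduct_sum_mulVec_le (P := P) (n := Fin n)
    (X := fun l ω i => ε l i ω) (fun l => measurable_pi_lambda _ (hε l)) (iIndepFun_curry hε hind)
    (M := formMatrix κ B) (fun p q => (continuous_formMatrix_apply κ B p q).measurable)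
    (posSemidef_formMatrix (by positivity) B) (s := 184320 * b ^ 8 / ν ^ 4) (by positivity)
    (fun l c => integrable_continuous_comp_of_bounded (hε l) (hb l)
      (g := fun a => c ⬝ᵥ (formMatrix κ B a *ᵥ c)) (continuous_const.dotProduct (hcont c)))
    (fun l c => integrable_continuous_comp_of_bounded (hε l) (hb l)
      (g := fun a => (formMatrix κ B a *ᵥ c) ⬝ᵥ (formMatrix κ B a *ᵥ c))
      ((hcont c).dotProduct (hcont c)))
    (fun l c => dotProduct_self_le_integral_formMatrix hd hν (hε l) (hindl l) (hb l) (h1 l) (h2 l)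
      (h3 l) (h4 l) hBT hBn c)
    (fun l c => integral_formMatrix_mulVec_le hd.pos hν (hε l) (hindl l) (hb l) hb0 (h1 l) hx
      hBT hBn c) hδ
  rw [Fintype.card_fin, Fintype.card_fin] at key
  refine (measureReal_mono ?_).trans (key.trans ?_)
  · intro ω hω
    simp only [RobustlyInjective, Set.mem_ofPred_eq, not_forall, not_lt, gt_iff_lt] at hω
    obtain ⟨Z, hZ, hZ0, hle⟩ := hω
    obtain ⟨c, rfl⟩ := hBs Z hZ
    refine ⟨c, fun hc => hZ0 (by simp [hc]), ?_⟩
    rw [norm_measurementOp_sq hZ, hBn] at hle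
    rw [sum_mulVec, dotProduct_sum]
    simp only [dotProduct_formMatrix_mulVec, ← sq]
    rw [← Finset.mul_sum, hκ]
    calc _ = L * ((ν ^ 2 * d * L)⁻¹ * ∑ l, ∑ k, traceRe (fun i => ε l i ω) k
          (∑ p, (c p : ℂ) • B p) ^ 2) := by
          field_simp
      _ ≤ L * ((1 - δ) * (c ⬝ᵥ c)) := by gcongr
      _ = _ := by ring
  · have hcard : (n : ℝ) ≤ (d : ℝ) ^ 2 := by
      have h : (n : ℝ) + 1 ≤ 2 * d := by exact_mod_cast hn
      nlinarith [sq_nonneg ((d : ℝ) - 1)]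
    have hexp : (L : ℝ) * δ ^ 2 / (2 * (184320 * b ^ 8 / ν ^ 4)) =
        ν ^ 4 * δ ^ 2 * L / (368640 * b ^ 8) := by
      field_simp
      ring
    rw [hexp]
    gcongr

end Concentration

end CodedDiffraction

/-! ### The main statement. -/

theorem proposition1 :
    ∃ C₁ : ℝ, 0 < C₁ ∧ ∃ C₁' : ℝ, 0 < C₁' ∧
      ∀ (d L : ℕ) (_ : Odd d) (_ : 0 < L)
        (Ω₀ : Type*) [MeasurableSpace Ω₀] (P₀ : Measure Ω₀) [IsProbabilityMeasure P₀]
        (ε₀ : Ω₀ → ℝ) (b ν : ℝ)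
        (_ : ∫ ω, ε₀ ω ∂P₀ = 0)
        (_ : ∫ ω, ε₀ ω ^ 3 ∂P₀ = 0)
        (_ : ∀ᵐ ω ∂P₀, |ε₀ ω| ≤ b)
        (_ : ν = ∫ ω, ε₀ ω ^ 2 ∂P₀)
        (_ : 0 < ν)
        (_ : ∫ ω, ε₀ ω ^ 4 ∂P₀ = 2 * ν ^ 2)
        (Ω : Type*) [MeasurableSpace Ω] (P : Measure Ω) [IsProbabilityMeasure P]
        (ε : Fin L → Fin d → Ω → ℝ)
        (_ : iIndepFun (fun p : Fin L × Fin d => ε p.1 p.2) P)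
        (_ : ∀ l i, IdentDistrib (ε l i) ε₀ P P₀)
        (x : EuclideanSpace ℂ (Fin d)) (_ : ‖x‖ = 1),
        P.real {ω | ¬ CodedDiffraction.RobustlyInjective ν (1 / 4) x (fun l i => ε l i ω)} <
            (d : ℝ) ^ 2 * Real.exp (-(ν ^ 4 * L / (C₁ * b ^ 8))) ∧
          ∀ δ : ℝ, 0 < δ → δ < 1 →
            P.real {ω | ¬ CodedDiffraction.RobustlyInjective ν (1 - δ) x (fun l i => ε l i ω)} ≤
              (d : ℝ) ^ 2 * Real.exp (-(ν ^ 4 * δ ^ 2 * L / (C₁' * b ^ 8))) := by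
  -- The second constant is `2 · 184320`, from the exponent `L δ²/(2s)`; the first is its double,
  -- which leaves room for strict inequality.
  refine ⟨737280, by norm_num, 368640, by norm_num, ?_⟩
  intro d L hd hL Ω₀ _ P₀ _ ε₀ b ν h1 h3 hb h2 hν h4 Ω _ P _ ε hind hid x hx
  have hb0 : 0 < b := by
    by_contra! hle
    have h0 : ∀ᵐ ω ∂P₀, ε₀ ω ^ 2 = 0 := by
      filter_upwards [hb] with ω hω
      have : |ε₀ ω| = 0 := le_antisymm (hω.trans hle) (abs_nonneg _)
      rw [← sq_abs, this]
      norm_num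
    rw [integral_congr_ae h0, integral_zero] at h2
    exact hν.ne' h2
  -- Equality in distribution only provides almost everywhere measurability, so measurable
  -- modifications replace the `ε l i`; this preserves the laws, the independence and the
  -- probability of failure.
  have hae : ∀ l i, ε l i =ᵐ[P] (hid l i).aemeasurable_fst.mk (ε l i) := fun l i =>
    (hid l i).aemeasurable_fst.ae_eq_mk
  set ε' : Fin L → Fin d → Ω → ℝ := fun l i => (hid l i).aemeasurable_fst.mk (ε l i) with hε'
  have hid' : ∀ l i, IdentDistrib (ε' l i) ε₀ P P₀ := fun l i =>
    (IdentDistrib.of_ae_eq (hid l i).aemeasurable_fst (hae l i)).symm.trans (hid l i)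
  have hpow : ∀ (m : ℕ) l i, ∫ ω, ε' l i ω ^ m ∂P = ∫ ω, ε₀ ω ^ m ∂P₀ := fun m l i =>
    ((hid' l i).comp (measurable_id.pow_const m)).integral_eq
  have hmain : ∀ δ : ℝ, 0 ≤ δ →
      P.real {ω | ¬ CodedDiffraction.RobustlyInjective ν (1 - δ) x (fun l i => ε l i ω)} ≤
        (d : ℝ) ^ 2 * Real.exp (-(ν ^ 4 * δ ^ 2 * L / (368640 * b ^ 8))) := by
    intro δ hδ
    have hcongr : P.real {ω | ¬ CodedDiffraction.RobustlyInjective ν (1 - δ) x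
          (fun l i => ε l i ω)} =
        P.real {ω | ¬ CodedDiffraction.RobustlyInjective ν (1 - δ) x (fun l i => ε' l i ω)} := by
      refine measureReal_congr ?_
      filter_upwards [ae_all_iff.mpr fun l => ae_all_iff.mpr (hae l)] with ω hω
      have : (fun l i => ε l i ω) = fun l i => ε' l i ω := by
        ext l i
        exact hω l i
      change (¬ CodedDiffraction.RobustlyInjective ν (1 - δ) x (fun l i => ε l i ω)) =
        ¬ CodedDiffraction.RobustlyInjective ν (1 - δ) x (fun l i => ε' l i ω)
      rw [this]
    rw [hcongr]
    exact CodedDiffraction.measure_not_robustlyInjective_le hd hL hν hb0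
      (fun l i => (hid l i).aemeasurable_fst.measurable_mk)
      (hind.congr fun p => hae p.1 p.2)
      (fun l i => (hid' l i).symm.ae_snd (p := fun y => |y| ≤ b)
        (measurableSet_le measurable_id.abs measurable_const) hb)
      (fun l i => (hid' l i).integral_eq.trans h1) (fun l i => (hpow 2 l i).trans h2.symm)
      (fun l i => (hpow 3 l i).trans h3) (fun l i => (hpow 4 l i).trans h4) hx hδ
  refine ⟨?_, fun δ hδ _ => hmain δ hδ.le⟩
  -- Here `δ² = 9/16 > 1/2`, so the exponent strictly beats the one with the doubled constant.
  have hquarter := hmain (3 / 4) (by norm_num)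
  rw [show (1 : ℝ) - 3 / 4 = 1 / 4 by norm_num] at hquarter
  have hL0 : (0 : ℝ) < L := Nat.cast_pos.mpr hL
  have hd0 : (0 : ℝ) < d := Nat.cast_pos.mpr hd.pos
  refine hquarter.trans_lt ?_
  gcongr ?_ * ?_
  rw [Real.exp_lt_exp, neg_lt_neg_iff, div_lt_div_iff₀ (by positivity) (by positivity)]
  have hpos : 0 < ν ^ 4 * L * b ^ 8 := by positivity
  nlinarith
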